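/- Let $X$ be a connected complex manifold (Hausdorff, second countable, of finite dimension) that is taut: $X$ is Kobayashi hyperbolic, and every map in the closure of $\mathrm{Hol}(\Delta,X)$ in $C^0(\Delta,X^*)$ either lies in $\mathrm{Hol}(\Delta,X)$ or is the constant map $\infty$. Here $\Delta\subset\mathbb{C}$ is the open unit disk, $X^*=X\cup\{\infty\}$ is the one-point compactification of $X$, and spaces of continuous maps carry the compact-open topology. Let $f\colon X\to X$ be holomorphic, and assume that the sequence $\{f^k\}$ of its iterates is not compactly divergent, i.e. it is not true that for all compact sets $H,K\subseteq X$ one has $f^k(H)\cap K=\varnothing$ for all sufficiently large $k$. Let $\Gamma(f)\subset C^0(X,X)$ be the set of limit maps of $f$, that is, the limits, uniform on compact subsets, of subsequences of $\{f^k\}$. Then there is exactly one holomorphic retraction $\rho$ (a holomorphic map $\rho\colon X\to X$ with $\rho\circ\rho=\rho$) in $\Gamma(f)$. Its image $M=\rho(X)$ is a closed complex submanifold of $X$. Every limit map $h\in\Gamma(f)$ is of the form $h=\gamma\circ\rho$ with $\gamma\in\mathrm{Aut}(M)$, the group of holomorphic automorphisms of $M$ with the compact-open topology. Furthermore, $f(M)\subseteq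 M$ and $\varphi=f|_M\in\mathrm{Aut}(M)$; the closure $G$ of $\{\varphi^k\mid k\in\mathbb{N}\}$ in $\mathrm{Aut}(M)$ is a subgroup of $\mathrm{Aut}(M)$; $\Gamma(f)$ is closed under composition; and $\gamma\circ\rho\mapsto\gamma$ is an isomorphism of topological groups from $\Gamma(f)$, with composition as product, onto $G$. -/

import Mathlib

open scoped Manifold Topology ENNReal ComplexConjugate

/-- The model space `ℂⁿ` of complex manifolds of dimension `n`. A complex `n`-manifold is a charted
space over it with `IsManifold 𝓘(ℂ, ComplexSpace n) 1`: the changes of charts are complex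
continuously differentiable, which is to say holomorphic. -/
abbrev ComplexSpace (n : ℕ) : Type := EuclideanSpace ℂ (Fin n)

/-! ### Kobayashi hyperbolic and taut manifolds -/

/-- The open unit disk `Δ` of the complex plane, a complex manifold as an open subset of `ℂ`. -/
def unitDisk : TopologicalSpace.Opens ℂ := ⟨Metric.ball 0 1, Metric.isOpen_ball⟩

/-- The Poincaré distance of the unit disk, normalized to have curvature `-4`. -/
noncomputable def poincareDist (ζ₁ ζ₂ : unitDisk) : ℝ :=
  1 / 2 * Real.log ((1 + ‖((ζ₁ : ℂ) - ζ₂) / (1 - conj (ζ₁ : ℂ) * ζ₂)‖) /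
    (1 - ‖((ζ₁ : ℂ) - ζ₂) / (1 - conj (ζ₁ : ℂ) * ζ₂)‖))

section Hyperbolic

variable {E : Type*} [NormedAddCommGroup E] [NormedSpace ℂ E] {H : Type*} [TopologicalSpace H]
  (I : ModelWithCorners ℂ E H) {X : Type*} [TopologicalSpace X] [ChartedSpace H X]

/-- The Lempert function `δ_X`, with value `∞` where no holomorphic disk joins the two points. -/
noncomputable def lempertFunction (z w : X) : ℝ≥0∞ :=
  ⨅ (φ : unitDisk → X) (ζ₀ : unitDisk) (ζ₁ : unitDisk)
    (_ : MDifferentiable 𝓘(ℂ) I φ ∧ φ ζ₀ = z ∧ φ ζ₁ = w),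
    ENNReal.ofReal (poincareDist ζ₀ ζ₁)

/-- The Kobayashi pseudodistance `k_X`: the infimum, over all finite chains `z = c₀, …, cₖ = w`,
of the sums of the values of the Lempert function. -/
noncomputable def kobayashiDist (z w : X) : ℝ≥0∞ :=
  ⨅ (k : ℕ) (c : ℕ → X) (_ : c 0 = z ∧ c k = w),
    ∑ j ∈ Finset.range k, lempertFunction I (c j) (c (j + 1))

variable (X)

/-- `X` is (Kobayashi) hyperbolic: its Kobayashi pseudodistance separates points. -/
def IsKobayashiHyperbolic : Prop :=
  ∀ z w : X, kobayashiDist I z w = 0 → z = w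

/-- `Hol(Δ, X)` as a subset of `C⁰(Δ, X*)`, where `X* = OnePoint X` is the one-point
compactification of `X`. -/
def holDisksInOnePoint : Set C(unitDisk, OnePoint X) :=
  {g | ∃ φ : unitDisk → X, MDifferentiable 𝓘(ℂ) I φ ∧ ∀ ζ, g ζ = (φ ζ : OnePoint X)}

/-- `X` is taut: it is hyperbolic, and every map in the closure of `Hol(Δ, X)` in `C⁰(Δ, X*)`
(with the compact-open topology) is in `Hol(Δ, X)` or is the constant map `∞`. -/
def IsTaut : Prop :=
  IsKobayashiHyperbolic I X ∧
    ∀ g ∈ closure (holDisksInOnePoint I X),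
      g ∈ holDisksInOnePoint I X ∨ g = ContinuousMap.const unitDisk OnePoint.infty

end Hyperbolic

/-! ### Iteration -/

/-- A sequence of continuous maps is compactly divergent if the images of every compact set
eventually leave every compact set. -/
def IsCompactlyDivergent {Y X : Type*} [TopologicalSpace Y] [TopologicalSpace X]
    (F : ℕ → C(Y, X)) : Prop :=
  ∀ (H : Set Y) (K : Set X), IsCompact H → IsCompact K →
    ∃ ν₀ : ℕ, ∀ ν ≥ ν₀, F ν '' H ∩ K = ∅

/-- The `k`-th iterate of a continuous self-map. -/
def iterateMap {X : Type*} [TopologicalSpace X] (f : C(X, X)) (k : ℕ) : C(X, X) :=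
  ⟨f^[k], f.continuous.iterate k⟩

/-- The set `Γ(f)` of the limit maps of `f`: the limits, in the compact-open topology (that is,
uniformly on compact subsets), of subsequences of the sequence of iterates of `f`. -/
def limitMaps {X : Type*} [TopologicalSpace X] (f : C(X, X)) : Set C(X, X) :=
  {g | ∃ k : ℕ → ℕ, StrictMono k ∧
    Filter.Tendsto (fun ν => iterateMap f (k ν)) Filter.atTop (𝓝 g)}

section Holomorphic

variable {E : Type*} [NormedAddCommGroup E] [NormedSpace ℂ E] {H : Type*} [TopologicalSpace H]
  (I : ModelWithCorners ℂ E H) {X : Type*} [TopologicalSpace X] [ChartedSpace H X]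

/-- A holomorphic retraction: a holomorphic self-map `ρ` with `ρ ∘ ρ = ρ`. -/
def IsHolomorphicRetraction (ρ : C(X, X)) : Prop :=
  MDifferentiable I I ρ ∧ ρ.comp ρ = ρ

variable (X)

/-- The group of the holomorphic automorphisms of `X`, under composition. -/
def holomorphicAutSubgroup : Subgroup (X ≃ₜ X) where
  carrier := {γ | MDifferentiable I I γ ∧ MDifferentiable I I γ.symm}
  one_mem' := ⟨mdifferentiable_id, mdifferentiable_id⟩
  mul_mem' {_ _} ha hb := ⟨ha.1.comp hb.1, hb.2.comp ha.2⟩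
  inv_mem' {_} ha := ⟨ha.2, ha.1⟩

/-- The group `Aut(X)` of the holomorphic automorphisms of `X`. -/
abbrev HolomorphicAut : Type _ := holomorphicAutSubgroup I X

/-- `Aut(X)` carries the compact-open topology. -/
instance HolomorphicAut.instTopologicalSpace : TopologicalSpace (HolomorphicAut I X) :=
  TopologicalSpace.induced
    (fun γ => (⟨γ.1, γ.1.continuous⟩ : C(X, X))) ContinuousMap.compactOpen

end Holomorphic

/-! ### Closed complex submanifolds -/

/-- The given charts make the subset `M` of the complex `n`-manifold `X` into a closed complex
submanifold of dimension `d`: `M` is closed, the charts form a holomorphic atlas, and the inclusion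
into `X` is a holomorphic embedding. (Such a complex structure on `M` is unique.) -/
structure IsClosedComplexSubmanifold (n d : ℕ) {X : Type*} [TopologicalSpace X]
    [ChartedSpace (ComplexSpace n) X] (M : Set X) [ChartedSpace (ComplexSpace d) M] : Prop where
  isClosed : IsClosed M
  isManifold : IsManifold 𝓘(ℂ, ComplexSpace d) 1 M
  isEmbedding : Manifold.IsSmoothEmbedding 𝓘(ℂ, ComplexSpace d) 𝓘(ℂ, ComplexSpace n) 1
    (Subtype.val : M → X)

/-!
The Kobayashi pseudodistance of a hyperbolic manifold separates points. A chain
of disks can be replaced by a path without leaving the Kobayashi ball, as Poincaré balls are convex,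
so the pseudodistance even induces the topology (Barth's theorem,
`IsKobayashiHyperbolic.exists_pos_forall_lt_mem`). Holomorphic self-maps do not increase it, hence
they are equicontinuous as maps into the one-point compactification. A limit of such maps along an
ultrafilter therefore exists in `X*`, and tautness, applied along disks, says that the set where it
equals `∞` is open and closed. This is the normality theorem
`IsTaut.isCompact_setOf_mdifferentiable`: the holomorphic self-maps sending a given point into a
given compact set form a compact set.

If the iterates of `f` are not compactly divergent, some orbit accumulates and normality provides a
limit map. If `f^kᵥ → g` and `f^mᵥ → g'` with `kᵥ - mᵥ → ∞`, then `f^(kᵥ - mᵥ)` sends `g' x` close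
to `g x`, so by normality it has a limit map `h`, and `h ∘ g' = g`. The limit maps thus form a
commutative semigroup in which one can always divide, that is, an abelian group
(`IsTaut.exists_unit_limitMaps`). Its neutral element is `ρ`, and it is the only retraction among
the limit maps because a group has only one idempotent.

The image of a holomorphic retraction is a submanifold by Cartan's argument: near a fixed point `ρ`
is conjugate to its derivative, a linear projection (`exists_isLinearizingChart`). The charts of `X`
in which `ρ` is linear give both the atlas of `ρ(X)` and the normal form of the inclusion. The rank
of the projection does not depend on the linearizing chart and is locally constant, hence constant
on the connected set `ρ(X)` (`exists_isClosedComplexSubmanifold_range`).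

Finally, `h = ρ ∘ h = h ∘ ρ` for every limit map `h`, so `h` is determined by its restriction to
`ρ(X)`, whose inverse is the restriction of the inverse of `h`. Restriction `h ↦ h|ρ(X)` and
extension `γ ↦ γ ∘ ρ` are continuous for the compact-open topologies, and the set of limit maps is
closed; therefore restriction is a homeomorphism onto the closure of the powers of `f|ρ(X)`.
-/

/-! ### Holomorphic maps in several variables -/

section SeveralVariables

open Filter Metric Set

variable {E F : Type*} [NormedAddCommGroup E] [NormedSpace ℂ E] [NormedAddCommGroup F]
  [NormedSpace ℂ F]

/-- A Cauchy estimate for the Fréchet derivative. -/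
lemma norm_fderiv_le_of_forall_mem_ball_norm_le {f : E → F} {x : E} {r C : ℝ} (hr : 0 < r)
    (hf : DifferentiableOn ℂ f (ball x r)) (hC : ∀ z ∈ ball x r, ‖f z‖ ≤ C) :
    ‖fderiv ℂ f x‖ ≤ 2 * C / r := by
  refine Complex.norm_fderiv_le_div_of_mapsTo_ball hf (fun z hz => ?_) hr
  rw [mem_closedBall, dist_eq_norm]
  have h1 := hC z hz
  have h2 := hC x (mem_ball_self hr)
  have h3 := norm_sub_le (f z) (f x)
  linarith

variable [ProperSpace E]

/-- A locally uniform limit of holomorphic maps is holomorphic: by the Cauchy estimate, the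
derivatives are locally uniformly Cauchy. -/
lemma TendstoLocallyUniformlyOn.differentiableOn_of_properSpace [CompleteSpace F] {ι : Type*}
    {l : Filter ι} [l.NeBot] {f : ι → E → F} {g : E → F} {s : Set E} (hs : IsOpen s)
    (h : TendstoLocallyUniformlyOn f g l s) (hf : ∀ᶠ i in l, DifferentiableOn ℂ (f i) s) :
    DifferentiableOn ℂ g s := by
  intro x hx
  obtain ⟨R, hR, hRs⟩ := nhds_basis_closedBall.mem_iff.1 (hs.mem_nhds hx)
  obtain ⟨r, hr, rfl⟩ : ∃ r, 0 < r ∧ 2 * r = R := ⟨R / 2, by positivity, by ring⟩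
  have hu : TendstoUniformlyOn f g l (closedBall x (2 * r)) :=
    (tendstoLocallyUniformlyOn_iff_tendstoUniformlyOn_of_compact (isCompact_closedBall _ _)).1
      (h.mono hRs)
  have hsub : ∀ y ∈ ball x r, ball y r ⊆ closedBall x (2 * r) := fun y hy z hz => by
    rw [mem_ball] at hy hz
    rw [mem_closedBall]
    linarith [dist_triangle z y x]
  have hat : ∀ i, DifferentiableOn ℂ (f i) s → ∀ y ∈ ball x r, DifferentiableAt ℂ (f i) y :=
    fun i hi y hy => hi.differentiableAt
      (hs.mem_nhds (hRs (hsub y hy (mem_ball_self hr))))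
  have hc : UniformCauchySeqOn (fun i => fderiv ℂ (f i)) l (ball x r) := by
    intro u hu'
    obtain ⟨ε, hε, hεu⟩ := mem_uniformity_dist.1 hu'
    have h1 := hu.uniformCauchySeqOn _ (dist_mem_uniformity (show 0 < ε * r / 4 by positivity))
    filter_upwards [h1, hf.prod_mk hf] with m hm hd y hy
    apply hεu
    rw [dist_eq_norm, ← fderiv_fun_sub (hat _ hd.1 y hy) (hat _ hd.2 y hy)]
    have := norm_fderiv_le_of_forall_mem_ball_norm_le (f := fun z => f m.1 z - f m.2 z) (x := y)
      (C := ε * r / 4) hr ((hd.1.mono ((hsub y hy).trans hRs)).sub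
        (hd.2.mono ((hsub y hy).trans hRs))) (fun z hz => by
          rw [← dist_eq_norm]; exact (hm z (hsub y hy hz)).le)
    refine this.trans_lt ?_
    rw [div_lt_iff₀ hr]
    nlinarith [mul_pos hε hr]
  have hlim : ∀ y ∈ ball x r, ∃ A, Tendsto (fun i => fderiv ℂ (f i) y) l (𝓝 A) := fun y hy =>
    CompleteSpace.complete (hc.cauchy_map hy)
  choose! g' hg' using hlim
  have h2 : TendstoUniformlyOnFilter (fun i => fderiv ℂ (f i)) g' l (𝓝 x) :=
    ((hc.tendstoUniformlyOn_of_tendsto hg').tendstoUniformlyOnFilter).mono_right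
      (le_principal_iff.2 (ball_mem_nhds x hr))
  have hg : HasFDerivAt g (g' x) x := by
    refine hasFDerivAt_of_tendstoUniformlyOnFilter (f := f) h2 ?_ ?_
    · filter_upwards [hf.prod_mk (ball_mem_nhds x hr)] with p hp
      exact (hat _ hp.1 _ hp.2).hasFDerivAt
    · filter_upwards [hs.mem_nhds hx] with y hy using h.tendsto_at hy
  exact hg.differentiableAt.differentiableWithinAt

/-- A holomorphic map of several variables is continuously differentiable. -/
lemma DifferentiableOn.contDiffOn_one_of_properSpace {f : E → F} {s : Set E} (hs : IsOpen s)
    (hf : DifferentiableOn ℂ f s) : ContDiffOn ℂ 1 f s := by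
  rw [show (1 : WithTop ℕ∞) = 0 + 1 from rfl, contDiffOn_succ_iff_fderiv_of_isOpen hs]
  refine ⟨hf, by simp, contDiffOn_zero.2 fun x hx => ContinuousAt.continuousWithinAt ?_⟩
  obtain ⟨R, hR, hRs⟩ := nhds_basis_closedBall.mem_iff.1 (hs.mem_nhds hx)
  obtain ⟨r, hr, rfl⟩ : ∃ r, 0 < r ∧ 2 * r = R := ⟨R / 2, by positivity, by ring⟩
  have huc := (isCompact_closedBall x (2 * r)).uniformContinuousOn_of_continuous
    (hf.continuousOn.mono hRs)
  rw [Metric.uniformContinuousOn_iff] at huc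
  rw [Metric.continuousAt_iff]
  intro ε hε
  obtain ⟨δ, hδ, hδ'⟩ := huc (ε * r / 4) (by positivity)
  refine ⟨min δ r, lt_min hδ hr, fun {y} hy => ?_⟩
  rw [lt_min_iff, dist_eq_norm] at hy
  have hz : ∀ z ∈ ball x r, z + (y - x) ∈ closedBall x (2 * r) := fun z hz => by
    rw [mem_ball, dist_eq_norm] at hz
    rw [mem_closedBall, dist_eq_norm]
    calc ‖z + (y - x) - x‖ = ‖(z - x) + (y - x)‖ := by congr 1; abel
      _ ≤ _ := by linarith [norm_add_le (z - x) (y - x)]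
  have hb : ball x r ⊆ closedBall x (2 * r) :=
    ball_subset_closedBall.trans (closedBall_subset_closedBall (by linarith))
  have hy' : DifferentiableAt ℂ f (x + (y - x)) :=
    hf.differentiableAt (hs.mem_nhds (hRs (hz x (mem_ball_self hr))))
  have e1 : fderiv ℂ (fun z => f (z + (y - x)) - f z) x = fderiv ℂ f y - fderiv ℂ f x := by
    rw [fderiv_fun_sub ((differentiableAt_comp_add_right _).2 hy')
      (hf.differentiableAt (hs.mem_nhds hx)), fderiv_comp_add_right]
    simp
  rw [dist_eq_norm, ← e1]
  have := norm_fderiv_le_of_forall_mem_ball_norm_le (f := fun z => f (z + (y - x)) - f z) (x := x)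
    (C := ε * r / 4) hr (DifferentiableOn.sub (fun z hz' => DifferentiableAt.differentiableWithinAt
      ((differentiableAt_comp_add_right _).2 (hf.differentiableAt (hs.mem_nhds (hRs (hz z hz'))))))
      (hf.mono (hb.trans hRs))) (fun z hz' => by
        rw [← dist_eq_norm]
        exact (hδ' _ (hz z hz') _ (hb hz') (by simpa [dist_eq_norm] using hy.1)).le)
  refine this.trans_lt ?_
  rw [div_lt_iff₀ hr]
  nlinarith [mul_pos hε hr]

end SeveralVariables

/-! ### The Poincaré distance -/

lemma norm_lt_one_of_unitDisk (ζ : unitDisk) : ‖(ζ : ℂ)‖ < 1 := by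
  have := ζ.2
  change (ζ : ℂ) ∈ Metric.ball 0 1 at this
  simpa using this

lemma mem_unitDisk_of_norm_lt {z : ℂ} (h : ‖z‖ < 1) : z ∈ unitDisk := by
  change z ∈ Metric.ball 0 1
  simpa using h

lemma convex_unitDisk : Convex ℝ (unitDisk : Set ℂ) := convex_ball 0 1

lemma poincareDist_comm (ζ₁ ζ₂ : unitDisk) : poincareDist ζ₁ ζ₂ = poincareDist ζ₂ ζ₁ := by
  have h : ‖((ζ₁ : ℂ) - ζ₂) / (1 - conj (ζ₁ : ℂ) * ζ₂)‖ =
      ‖((ζ₂ : ℂ) - ζ₁) / (1 - conj (ζ₂ : ℂ) * ζ₁)‖ := by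
    rw [norm_div, norm_div, norm_sub_rev, ← Complex.norm_conj (1 - conj (ζ₁ : ℂ) * ζ₂)]
    simp [mul_comm]
  rw [poincareDist, poincareDist, h]

/-- The identity behind the pseudo-hyperbolic distance being less than `1`. -/
lemma normSq_one_sub_conj_mul_sub (a b : ℂ) :
    ‖1 - conj a * b‖ ^ 2 - ‖a - b‖ ^ 2 = (1 - ‖a‖ ^ 2) * (1 - ‖b‖ ^ 2) := by
  simp only [← Complex.normSq_eq_norm_sq, Complex.normSq_apply, Complex.sub_re, Complex.sub_im,
    Complex.mul_re, Complex.mul_im, Complex.conj_re, Complex.conj_im, Complex.one_re,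
    Complex.one_im]
  ring

lemma norm_one_sub_conj_mul_pos (a b : unitDisk) : 0 < ‖1 - conj (a : ℂ) * b‖ := by
  have ha := norm_lt_one_of_unitDisk a
  have hb := norm_lt_one_of_unitDisk b
  refine norm_pos_iff.2 fun h => ?_
  have h1 : ‖conj (a : ℂ) * b‖ = 1 := by rw [← sub_eq_zero.1 h, norm_one]
  rw [norm_mul, Complex.norm_conj] at h1
  nlinarith [norm_nonneg (a : ℂ), norm_nonneg (b : ℂ)]

lemma norm_pseudoHyperbolic_lt_one (a b : unitDisk) :
    ‖((a : ℂ) - b) / (1 - conj (a : ℂ) * b)‖ < 1 := by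
  have h1 := normSq_one_sub_conj_mul_sub (a : ℂ) b
  have ha : ‖(a : ℂ)‖ ^ 2 < 1 := by
    have := norm_lt_one_of_unitDisk a; nlinarith [norm_nonneg (a : ℂ)]
  have hb : ‖(b : ℂ)‖ ^ 2 < 1 := by
    have := norm_lt_one_of_unitDisk b; nlinarith [norm_nonneg (b : ℂ)]
  rw [norm_div, div_lt_one (norm_one_sub_conj_mul_pos a b)]
  refine lt_of_pow_lt_pow_left₀ 2 (norm_nonneg _) ?_
  nlinarith [mul_pos (sub_pos.2 ha) (sub_pos.2 hb)]

/-- Poincaré balls are Euclidean disks, hence convex: along a Euclidean segment, the Poincaré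
distance from one end is at most its value at the other end. -/
lemma poincareDist_le_of_eq_add_smul {a b c : unitDisk} {t : ℝ} (ht0 : 0 ≤ t) (ht1 : t ≤ 1)
    (hc : (c : ℂ) = a + t * (b - a)) : poincareDist a c ≤ poincareDist a b := by
  have ha := norm_lt_one_of_unitDisk a
  have hb := norm_lt_one_of_unitDisk b
  -- the convexity inequality, after the common factor `‖a - b‖` is removed
  have key : t * ‖1 - conj (a : ℂ) * b‖ ≤ ‖1 - conj (a : ℂ) * c‖ := by
    refine le_of_sq_le_sq ?_ (norm_nonneg _)
    have hre : ((a : ℂ).re * (b : ℂ).re + (a : ℂ).im * (b : ℂ).im) ≤ ‖(a : ℂ)‖ := by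
      have h1 : (a : ℂ).re * (b : ℂ).re + (a : ℂ).im * (b : ℂ).im = (conj (a : ℂ) * b).re := by
        simp
      rw [h1]
      refine (Complex.re_le_norm _).trans ?_
      rw [norm_mul, Complex.norm_conj]
      exact mul_le_of_le_one_right (norm_nonneg _) hb.le
    have hn : ‖(a : ℂ)‖ ^ 2 = (a : ℂ).re * (a : ℂ).re + (a : ℂ).im * (a : ℂ).im := by
      rw [← Complex.normSq_eq_norm_sq, Complex.normSq_apply]
    have h0 := norm_nonneg (a : ℂ)
    have hid : ‖1 - conj (a : ℂ) * c‖ ^ 2 - (t * ‖1 - conj (a : ℂ) * b‖) ^ 2 =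
        (1 - ‖(a : ℂ)‖ ^ 2) * (1 - t) * ((1 - ‖(a : ℂ)‖ ^ 2) * (1 + t) - 2 * t *
          ((a : ℂ).re * (b : ℂ).re + (a : ℂ).im * (b : ℂ).im - ‖(a : ℂ)‖ ^ 2)) := by
      rw [mul_pow, hn, hc]
      simp only [← Complex.normSq_eq_norm_sq, Complex.normSq_apply, Complex.sub_re,
        Complex.sub_im, Complex.mul_re, Complex.mul_im, Complex.conj_re, Complex.conj_im,
        Complex.one_re, Complex.one_im, Complex.add_re, Complex.add_im, Complex.ofReal_re,
        Complex.ofReal_im]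
      ring
    have h2 : 0 ≤ (1 - ‖(a : ℂ)‖ ^ 2) * (1 + t) - 2 * t *
          ((a : ℂ).re * (b : ℂ).re + (a : ℂ).im * (b : ℂ).im - ‖(a : ℂ)‖ ^ 2) := by
      have h3 : 0 ≤ (1 - ‖(a : ℂ)‖) * ((1 + ‖(a : ℂ)‖) * (1 + t) - 2 * t * ‖(a : ℂ)‖) :=
        mul_nonneg (by linarith) (by nlinarith)
      nlinarith [mul_nonneg ht0 (sub_nonneg.2 hre)]
    have h4 : 0 ≤ (1 - ‖(a : ℂ)‖ ^ 2) * (1 - t) := mul_nonneg (by nlinarith) (by linarith)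
    nlinarith [mul_nonneg h4 h2]
  have hle : ‖((a : ℂ) - c) / (1 - conj (a : ℂ) * c)‖ ≤
      ‖((a : ℂ) - b) / (1 - conj (a : ℂ) * b)‖ := by
    have e : (a : ℂ) - c = t * (a - b) := by rw [hc]; ring
    rw [norm_div, norm_div, div_le_div_iff₀ (norm_one_sub_conj_mul_pos a c)
      (norm_one_sub_conj_mul_pos a b), e, norm_mul, Complex.norm_real, Real.norm_of_nonneg ht0]
    nlinarith [norm_nonneg ((a : ℂ) - b)]
  have h1 := norm_pseudoHyperbolic_lt_one a b
  have h0 := norm_nonneg (((a : ℂ) - c) / (1 - conj (a : ℂ) * c))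
  unfold poincareDist
  refine mul_le_mul_of_nonneg_left (Real.log_le_log (div_pos (by linarith) (by linarith)) ?_)
    (by norm_num)
  exact div_le_div₀ (by linarith) (by linarith) (by linarith) (by linarith)

/-! ### The Kobayashi pseudodistance -/

section Kobayashi

open Filter Set

section General

variable {E : Type*} [NormedAddCommGroup E] [NormedSpace ℂ E] {H : Type*} [TopologicalSpace H]
  {I : ModelWithCorners ℂ E H} {X : Type*} [TopologicalSpace X] [ChartedSpace H X]

lemma lempertFunction_le {φ : unitDisk → X} (hφ : MDifferentiable 𝓘(ℂ) I φ) (ζ₀ ζ₁ : unitDisk) :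
    lempertFunction I (φ ζ₀) (φ ζ₁) ≤ ENNReal.ofReal (poincareDist ζ₀ ζ₁) :=
  iInf_le_of_le φ <| iInf_le_of_le ζ₀ <| iInf_le_of_le ζ₁ <| iInf_le_of_le ⟨hφ, rfl, rfl⟩ le_rfl

lemma exists_disk_of_lempertFunction_lt {z w : X} {a : ℝ≥0∞} (h : lempertFunction I z w < a) :
    ∃ (φ : unitDisk → X) (ζ₀ ζ₁ : unitDisk), MDifferentiable 𝓘(ℂ) I φ ∧ φ ζ₀ = z ∧ φ ζ₁ = w ∧
      ENNReal.ofReal (poincareDist ζ₀ ζ₁) < a := by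
  simp only [lempertFunction, iInf_lt_iff] at h
  obtain ⟨φ, ζ₀, ζ₁, ⟨h1, h2, h3⟩, h4⟩ := h
  exact ⟨φ, ζ₀, ζ₁, h1, h2, h3, h4⟩

lemma lempertFunction_comm (z w : X) : lempertFunction I z w = lempertFunction I w z := by
  suffices h : ∀ z w : X, lempertFunction I z w ≤ lempertFunction I w z from
    le_antisymm (h z w) (h w z)
  intro z w
  refine le_iInf fun φ => le_iInf fun ζ₀ => le_iInf fun ζ₁ => le_iInf fun ⟨h1, h2, h3⟩ => ?_
  rw [← h2, ← h3, poincareDist_comm]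
  exact lempertFunction_le h1 _ _

lemma kobayashiDist_le_sum (k : ℕ) (c : ℕ → X) :
    kobayashiDist I (c 0) (c k) ≤ ∑ j ∈ Finset.range k, lempertFunction I (c j) (c (j + 1)) :=
  iInf_le_of_le k <| iInf_le_of_le c <| iInf_le_of_le ⟨rfl, rfl⟩ le_rfl

lemma exists_chain_of_kobayashiDist_lt {z w : X} {a : ℝ≥0∞} (h : kobayashiDist I z w < a) :
    ∃ (k : ℕ) (c : ℕ → X), c 0 = z ∧ c k = w ∧
      ∑ j ∈ Finset.range k, lempertFunction I (c j) (c (j + 1)) < a := by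
  simp only [kobayashiDist, iInf_lt_iff] at h
  obtain ⟨k, c, ⟨h1, h2⟩, h3⟩ := h
  exact ⟨k, c, h1, h2, h3⟩

lemma kobayashiDist_le_lempertFunction (z w : X) :
    kobayashiDist I z w ≤ lempertFunction I z w := by
  simpa using kobayashiDist_le_sum (I := I) 1 (fun j => if j = 0 then z else w)

lemma kobayashiDist_comm (z w : X) : kobayashiDist I z w = kobayashiDist I w z := by
  suffices h : ∀ z w : X, kobayashiDist I z w ≤ kobayashiDist I w z from
    le_antisymm (h z w) (h w z)
  intro z w
  refine le_iInf fun k => le_iInf fun c => le_iInf fun ⟨h1, h2⟩ => ?_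
  have h := kobayashiDist_le_sum (I := I) k (fun j => c (k - j))
  simp only [tsub_zero, tsub_self, h1, h2] at h
  refine h.trans ((Finset.sum_range_reflect _ k).symm.trans_le (Finset.sum_le_sum fun j hj => ?_))
  rw [Finset.mem_range] at hj
  rw [lempertFunction_comm, show k - (k - 1 - j + 1) = j by omega,
    show k - (k - 1 - j) = j + 1 by omega]

lemma kobayashiDist_triangle (x y z : X) :
    kobayashiDist I x z ≤ kobayashiDist I x y + kobayashiDist I y z := by
  have key : ∀ (k : ℕ) (c : ℕ → X) (k' : ℕ) (c' : ℕ → X), c k = c' 0 →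
      kobayashiDist I (c 0) (c' k') ≤
        ∑ j ∈ Finset.range k, lempertFunction I (c j) (c (j + 1)) +
        ∑ j ∈ Finset.range k', lempertFunction I (c' j) (c' (j + 1)) := by
    intro k c k' c' h
    have h1 := kobayashiDist_le_sum (I := I) (k + k') (fun j => if j < k then c j else c' (j - k))
    rw [Finset.sum_range_add] at h1
    have h0 : (if 0 < k then c 0 else c' (0 - k)) = c 0 := by
      split_ifs with hk
      · rfl
      · obtain rfl : k = 0 := by omega
        exact h.symm
    simp only [h0, show ¬ k + k' < k by omega, if_false, add_tsub_cancel_left] at h1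
    refine h1.trans (add_le_add (Finset.sum_le_sum fun j hj => le_of_eq ?_)
      (Finset.sum_le_sum fun j _ => le_of_eq ?_))
    · rw [Finset.mem_range] at hj
      rw [if_pos hj]
      split_ifs with hj'
      · rfl
      · obtain rfl : k = j + 1 := by omega
        rw [h, tsub_self]
    · rw [if_neg (by omega), if_neg (by omega),
        show k + j + 1 - k = j + 1 by omega]
  refine ENNReal.le_of_forall_pos_le_add fun ε hε hfin => ?_
  have hε' : ((ε / 2 : NNReal) : ℝ≥0∞) ≠ 0 := by positivity
  obtain ⟨k, c, rfl, hc, hk⟩ := exists_chain_of_kobayashiDist_lt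
    (ENNReal.lt_add_right (ne_top_of_le_ne_top hfin.ne le_self_add) hε')
  obtain ⟨k', c', hc', rfl, hk'⟩ := exists_chain_of_kobayashiDist_lt
    (ENNReal.lt_add_right (ne_top_of_le_ne_top hfin.ne le_add_self) hε')
  refine (key k c k' c' (hc.trans hc'.symm)).trans ((add_le_add hk.le hk'.le).trans (le_of_eq ?_))
  rw [add_add_add_comm, ← ENNReal.coe_add, add_halves]

/-- Holomorphic maps do not increase the Lempert function. -/
lemma lempertFunction_map_le {f : X → X} (hf : MDifferentiable I I f) (z w : X) :
    lempertFunction I (f z) (f w) ≤ lempertFunction I z w := by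
  refine le_iInf fun φ => le_iInf fun ζ₀ => le_iInf fun ζ₁ => le_iInf fun ⟨h1, h2, h3⟩ => ?_
  rw [← h2, ← h3]
  exact lempertFunction_le (hf.comp h1) _ _

/-- Holomorphic maps do not increase the Kobayashi pseudodistance. -/
lemma kobayashiDist_map_le {f : X → X} (hf : MDifferentiable I I f) (z w : X) :
    kobayashiDist I (f z) (f w) ≤ kobayashiDist I z w := by
  refine le_iInf fun k => le_iInf fun c => le_iInf fun ⟨h1, h2⟩ => ?_
  rw [← h1, ← h2]
  exact (kobayashiDist_le_sum k (f ∘ c)).trans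
    (Finset.sum_le_sum fun j _ => lempertFunction_map_le hf _ _)

end General

variable {E : Type*} [NormedAddCommGroup E] [NormedSpace ℂ E] {X : Type*} [TopologicalSpace X]
  [ChartedSpace E X] [IsManifold 𝓘(ℂ, E) 1 X]

/-- Nearby points are joined by small affine disks in a chart. -/
lemma tendsto_lempertFunction_nhds_self (x : X) :
    Tendsto (lempertFunction 𝓘(ℂ, E) x) (𝓝 x) (𝓝 0) := by
  set e := chartAt E x with he
  have hx : x ∈ e.source := mem_chart_source E x
  obtain ⟨r, hr, hrt⟩ := Metric.mem_nhds_iff.1 (e.open_target.mem_nhds (e.map_source hx))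
  have hs : Tendsto (fun y => ‖e y - e x‖ / r) (𝓝 x) (𝓝 0) := by
    have : ContinuousAt (fun y => ‖e y - e x‖ / r) x :=
      (((e.continuousAt hx).sub continuousAt_const).norm).div_const r
    simpa [ContinuousAt] using this
  have hup : Tendsto (fun y => ENNReal.ofReal (1 / 2 * Real.log ((1 + ‖e y - e x‖ / r) /
      (1 - ‖e y - e x‖ / r)))) (𝓝 x) (𝓝 0) := by
    have : ContinuousAt (fun s : ℝ => 1 / 2 * Real.log ((1 + s) / (1 - s))) 0 := by
      refine continuousAt_const.mul (ContinuousAt.log (ContinuousAt.div ?_ ?_ ?_) ?_)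
      · fun_prop
      · fun_prop
      · norm_num
      · norm_num
    have h2 := ENNReal.tendsto_ofReal (this.tendsto.comp hs)
    simpa [Function.comp_def] using h2
  refine tendsto_of_tendsto_of_tendsto_of_le_of_le' tendsto_const_nhds hup
    (Eventually.of_forall fun _ => zero_le) ?_
  filter_upwards [e.open_source.mem_nhds hx, hs.eventually (gt_mem_nhds one_pos)] with y hy hy1
  set s : ℝ := ‖e y - e x‖ / r with hsdef
  have hs0 : 0 ≤ s := by positivity
  -- the disk `ζ ↦ e x + ζ w` passes through `e y` at the parameter `s`; if `y = x`, then `w = 0`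
  set w : E := ((r / ‖e y - e x‖ : ℝ) : ℂ) • (e y - e x) with hw
  have hwr : ‖w‖ ≤ r := by
    rw [hw, norm_smul, Complex.norm_real, Real.norm_of_nonneg (by positivity)]
    rcases eq_or_ne ‖e y - e x‖ 0 with h | h
    · simp [h, hr.le]
    · exact (div_mul_cancel₀ r h).le
  have hsw : (s : ℂ) • w = e y - e x := by
    rw [hw, smul_smul, ← Complex.ofReal_mul, hsdef]
    rcases eq_or_ne (e y - e x) 0 with h | h
    · simp [h]
    · have : ‖e y - e x‖ ≠ 0 := norm_ne_zero_iff.2 h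
      rw [show ‖e y - e x‖ / r * (r / ‖e y - e x‖) = 1 by field_simp]
      simp
  have hball : ∀ ζ : unitDisk, e x + (ζ : ℂ) • w ∈ e.target := fun ζ => hrt <| by
    rw [Metric.mem_ball, dist_eq_norm, add_sub_cancel_left, norm_smul]
    have := norm_lt_one_of_unitDisk ζ
    nlinarith [norm_nonneg w, norm_nonneg (ζ : ℂ)]
  have hφ : MDifferentiable 𝓘(ℂ) 𝓘(ℂ, E) (fun ζ : unitDisk => e.symm (e x + (ζ : ℂ) • w)) := by
    intro ζ
    refine MDifferentiableAt.comp (g := e.symm) (f := fun ζ : unitDisk => e x + (ζ : ℂ) • w) ζ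
      (mdifferentiableAt_atlas_symm (chart_mem_atlas E x) (hball ζ)) ?_
    refine MDifferentiableAt.comp (g := fun z : ℂ => e x + z • w)
      (f := fun ζ : unitDisk => (ζ : ℂ)) ζ ?_
      ((contMDiff_subtype_val (n := 1)).mdifferentiable (by simp) ζ)
    refine DifferentiableAt.mdifferentiableAt ?_
    fun_prop
  have hsn : ‖(s : ℂ)‖ < 1 := by rwa [Complex.norm_real, Real.norm_of_nonneg hs0]
  have h := lempertFunction_le hφ ⟨0, mem_unitDisk_of_norm_lt (by simp)⟩
    ⟨(s : ℂ), mem_unitDisk_of_norm_lt hsn⟩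
  simp only [hsw, zero_smul, add_zero, add_sub_cancel, e.left_inv hx, e.left_inv hy] at h
  refine h.trans (le_of_eq ?_)
  simp only [poincareDist, map_zero, zero_mul, sub_zero, div_one, zero_sub, norm_neg,
    Complex.norm_real, Real.norm_of_nonneg hs0]

lemma tendsto_kobayashiDist_nhds_self (x : X) :
    Tendsto (kobayashiDist 𝓘(ℂ, E) x) (𝓝 x) (𝓝 0) :=
  tendsto_of_tendsto_of_tendsto_of_le_of_le tendsto_const_nhds (tendsto_lempertFunction_nhds_self x)
    (fun _ => zero_le) fun _ => kobayashiDist_le_lempertFunction _ _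

/-- **Barth's theorem**: on a hyperbolic manifold, small Kobayashi balls are small. A chain of
disks leaving a relatively compact open neighbourhood of `p` crosses the frontier, and the
Kobayashi distance from `p` is bounded below on the frontier. -/
lemma IsKobayashiHyperbolic.exists_pos_forall_lt_mem [T2Space X] [LocallyCompactSpace X]
    (hX : IsKobayashiHyperbolic 𝓘(ℂ, E) X) {p : X} {U : Set X} (hU : U ∈ 𝓝 p) :
    ∃ ε : ℝ≥0∞, 0 < ε ∧ ∀ q, kobayashiDist 𝓘(ℂ, E) p q < ε → q ∈ U := by
  obtain ⟨K, ⟨hK, hKc⟩, hKU⟩ := (compact_basis_nhds p).mem_iff.1 hU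
  set O := interior K with hO
  have hpO : p ∈ O := mem_interior_iff_mem_nhds.2 hK
  have hfr : IsCompact (frontier O) :=
    hKc.of_isClosed_subset isClosed_frontier
      (frontier_subset_closure.trans (closure_minimal interior_subset hKc.isClosed))
  -- a lower bound on the frontier
  obtain ⟨ε, hε, hεfr⟩ : ∃ ε : ℝ≥0∞, 0 < ε ∧ ∀ z ∈ frontier O, ε ≤ kobayashiDist 𝓘(ℂ, E) p z := by
    refine hfr.induction_on (p := fun S => ∃ ε : ℝ≥0∞, 0 < ε ∧
      ∀ z ∈ S, ε ≤ kobayashiDist 𝓘(ℂ, E) p z) ⟨1, one_pos, by simp⟩ ?_ ?_ ?_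
    · rintro s t hst ⟨ε, hε, h⟩
      exact ⟨ε, hε, fun z hz => h z (hst hz)⟩
    · rintro s t ⟨ε, hε, h⟩ ⟨ε', hε', h'⟩
      refine ⟨min ε ε', lt_min hε hε', ?_⟩
      rintro z (hz | hz)
      · exact (min_le_left _ _).trans (h z hz)
      · exact (min_le_right _ _).trans (h' z hz)
    · intro z hz
      have hpz : p ≠ z := by
        rintro rfl
        exact ((isOpen_interior (s := K)).frontier_eq ▸ hz).2 hpO
      have hpos : 0 < kobayashiDist 𝓘(ℂ, E) p z := pos_iff_ne_zero.2 fun h => hpz (hX p z h)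
      set δ := kobayashiDist 𝓘(ℂ, E) p z / 2
      have hδ0 : 0 < δ := ENNReal.half_pos hpos.ne'
      refine ⟨{z' : X | kobayashiDist 𝓘(ℂ, E) z z' < δ}, mem_nhdsWithin_of_mem_nhds
        ((tendsto_kobayashiDist_nhds_self (E := E) z).eventually (gt_mem_nhds hδ0)), δ, hδ0,
        fun z' (hz' : kobayashiDist 𝓘(ℂ, E) z z' < δ) => ?_⟩
      by_contra! hlt
      have h1 := kobayashiDist_triangle (I := 𝓘(ℂ, E)) p z' z
      rw [kobayashiDist_comm z' z] at h1
      exact (h1.trans_lt (ENNReal.add_lt_add hlt hz')).not_ge (ENNReal.add_halves _).le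
  refine ⟨ε, hε, fun q hq => ?_⟩
  by_contra hqU
  have hqO : q ∉ O := fun h => hqU (hKU (interior_subset h))
  obtain ⟨k, c, hc0, hck, hsum⟩ := exists_chain_of_kobayashiDist_lt hq
  -- the first step that leaves `O`
  obtain ⟨j, hjk, hj, hj1⟩ : ∃ j < k, c j ∈ O ∧ c (j + 1) ∉ O := by
    by_contra! hcon
    have : ∀ i ≤ k, c i ∈ O := fun i => by
      induction i with
      | zero => intro _; rwa [hc0]
      | succ i ih => intro hi; exact hcon i (by omega) (ih (by omega))
    exact hqO (hck ▸ this k le_rfl)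
  have hsum' : ∑ i ∈ Finset.range j, lempertFunction 𝓘(ℂ, E) (c i) (c (i + 1)) +
      lempertFunction 𝓘(ℂ, E) (c j) (c (j + 1)) < ε := by
    rw [← Finset.sum_range_succ]
    exact (Finset.sum_le_sum_of_subset (Finset.range_mono hjk)).trans_lt hsum
  obtain ⟨φ, ζ₀, ζ₁, hφ, h0, h1, hlt⟩ := exists_disk_of_lempertFunction_lt
    (lt_tsub_iff_left.2 hsum')
  -- the image of the segment from `ζ₀` to `ζ₁` crosses the frontier
  have hseg : ∀ t : unitInterval, (ζ₀ : ℂ) + (t : ℝ) * (ζ₁ - ζ₀) ∈ unitDisk := fun t => by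
    have := convex_unitDisk.add_smul_sub_mem ζ₀.2 ζ₁.2 t.2
    simpa using this
  set g : unitInterval → X := fun t => φ ⟨_, hseg t⟩ with hg
  have hgc : Continuous g := hφ.continuous.comp (by fun_prop)
  have hg0 : g 0 = c j := by simp [hg, h0]
  have hg1 : g 1 = c (j + 1) := by simp [hg, h1]
  obtain ⟨t, ht⟩ : (frontier (g ⁻¹' O)).Nonempty := nonempty_frontier_iff.2
    ⟨⟨0, by rwa [mem_preimage, hg0]⟩, fun h => hj1 (by
      rw [← hg1, ← mem_preimage, h]; exact mem_univ _)⟩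
  replace ht : g t ∈ frontier O := hgc.frontier_preimage_subset _ ht
  refine (hεfr _ ht).not_gt ?_
  calc kobayashiDist 𝓘(ℂ, E) p (g t) ≤ kobayashiDist 𝓘(ℂ, E) (c 0) (c j) +
        kobayashiDist 𝓘(ℂ, E) (c j) (g t) := hc0 ▸ kobayashiDist_triangle _ _ _
    _ ≤ ∑ i ∈ Finset.range j, lempertFunction 𝓘(ℂ, E) (c i) (c (i + 1)) +
        ENNReal.ofReal (poincareDist ζ₀ ζ₁) := by
      refine add_le_add (kobayashiDist_le_sum _ _) ?_
      rw [← h0]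
      refine (kobayashiDist_le_lempertFunction _ _).trans ((lempertFunction_le hφ _ _).trans ?_)
      exact ENNReal.ofReal_le_ofReal (poincareDist_le_of_eq_add_smul t.2.1 t.2.2 rfl)
    _ < ε := lt_tsub_iff_left.1 hlt

end Kobayashi

/-! ### Continuous convergence and holomorphic limits -/

section ContinuousConvergence

open Filter Set

variable {ι Y Z : Type*} [TopologicalSpace Y] [TopologicalSpace Z] {l : Filter ι}

/-- The limit of a continuously convergent family is continuous. -/
lemma continuous_of_forall_tendsto_prod_nhds [RegularSpace Z] [l.NeBot] {F : ι → Y → Z}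
    {g : Y → Z} (h : ∀ y, Tendsto (fun p : ι × Y => F p.1 p.2) (l ×ˢ 𝓝 y) (𝓝 (g y))) :
    Continuous g := by
  have hpt : ∀ y, Tendsto (fun i => F i y) l (𝓝 (g y)) := fun y =>
    (h y).comp (tendsto_id.prodMk (tendsto_const_pure.mono_right (pure_le_nhds y)))
  refine continuous_iff_continuousAt.2 fun y => ?_
  refine (closed_nhds_basis (g y)).tendsto_right_iff.2 fun U hU => ?_
  obtain ⟨A, hA, V, hV, hAV⟩ := mem_prod_iff.1 (h y hU.1)
  filter_upwards [hV] with z hz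
  exact hU.2.mem_of_tendsto (hpt z) (mem_of_superset hA fun i hi => hAV (mk_mem_prod hi hz))

/-- Continuous convergence implies convergence in the compact-open topology. -/
lemma ContinuousMap.tendsto_of_forall_tendsto_prod_nhds {F : ι → C(Y, Z)} {g : C(Y, Z)}
    (h : ∀ y, Tendsto (fun p : ι × Y => F p.1 p.2) (l ×ˢ 𝓝 y) (𝓝 (g y))) :
    Tendsto F l (𝓝 g) := by
  refine ContinuousMap.tendsto_nhds_compactOpen.2 fun K hK U hU hKU => ?_
  have := hK.mem_prod_nhdsSet_of_forall (fun y hy => h y (hU.mem_nhds (hKU hy)))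
  obtain ⟨A, hA, V, hV, hAV⟩ := mem_prod_iff.1 this
  filter_upwards [hA] with i hi y hy
  exact hAV (mk_mem_prod hi (subset_of_mem_nhdsSet hV hy))

/-- Convergence in the compact-open topology on a locally compact space is continuous
convergence. -/
lemma ContinuousMap.tendsto_prod_nhds [LocallyCompactSpace Y] {F : ι → C(Y, Z)} {g : C(Y, Z)}
    (h : Tendsto F l (𝓝 g)) (y : Y) :
    Tendsto (fun p : ι × Y => F p.1 p.2) (l ×ˢ 𝓝 y) (𝓝 (g y)) := by
  have h1 := (continuous_eval (F := C(Y, Z))).tendsto (g, y)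
  rw [nhds_prod_eq] at h1
  exact h1.comp (h.prodMap tendsto_id)

end ContinuousConvergence

section HolomorphicLimits

open Filter Set

variable {E : Type*} [NormedAddCommGroup E] [NormedSpace ℂ E] {X : Type*} [TopologicalSpace X]
  [ChartedSpace E X] [IsManifold 𝓘(ℂ, E) 1 X]
  {E' : Type*} [NormedAddCommGroup E'] [NormedSpace ℂ E'] {Y : Type*} [TopologicalSpace Y]
  [ChartedSpace E' Y] [IsManifold 𝓘(ℂ, E') 1 Y]

/-- Limits of holomorphic maps in the compact-open topology are holomorphic. -/
lemma MDifferentiable.of_tendsto [ProperSpace E] [CompleteSpace E'] {ι : Type*} {l : Filter ι}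
    [l.NeBot] {F : ι → C(X, Y)} {g : C(X, Y)} (h : Tendsto F l (𝓝 g))
    (hF : ∀ᶠ i in l, MDifferentiable 𝓘(ℂ, E) 𝓘(ℂ, E') (F i)) :
    MDifferentiable 𝓘(ℂ, E) 𝓘(ℂ, E') g := by
  have : LocallyCompactSpace X := ChartedSpace.locallyCompactSpace E X
  intro x
  set e := chartAt E x with he
  set e' := chartAt E' (g x) with he'
  have hx : x ∈ e.source := mem_chart_source E x
  have hgx : g x ∈ e'.source := mem_chart_source E' (g x)
  have hnhds : e.target ∩ e.symm ⁻¹' (g ⁻¹' e'.source) ∈ 𝓝 (e x) := by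
    refine inter_mem (e.open_target.mem_nhds (e.map_source hx)) ?_
    refine (e.continuousAt_symm (e.map_source hx)).preimage_mem_nhds ?_
    rw [e.left_inv hx]
    exact g.continuous.continuousAt.preimage_mem_nhds (e'.open_source.mem_nhds hgx)
  obtain ⟨r, hr, hrs⟩ := Metric.nhds_basis_closedBall.mem_iff.1 hnhds
  have hK : IsCompact (e.symm '' Metric.closedBall (e x) r) :=
    (isCompact_closedBall _ _).image_of_continuousOn
      (e.continuousOn_symm.mono fun z hz => (hrs hz).1)
  have hev := ContinuousMap.tendsto_nhds_compactOpen.1 h _ hK _ e'.open_source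
    (by rintro _ ⟨z, hz, rfl⟩; exact (hrs hz).2)
  have hb : Metric.ball (e x) r ⊆ Metric.closedBall (e x) r := Metric.ball_subset_closedBall
  have hd : DifferentiableOn ℂ (fun z => e' (g (e.symm z))) (Metric.ball (e x) r) := by
    refine TendstoLocallyUniformlyOn.differentiableOn_of_properSpace (l := l)
      (f := fun i z => e' (F i (e.symm z))) Metric.isOpen_ball ?_ ?_
    · refine tendstoLocallyUniformlyOn_iff_forall_tendsto.2 fun z hz => ?_
      refine Tendsto.mono_left ?_ (Filter.prod_mono le_rfl nhdsWithin_le_nhds)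
      have hez : Tendsto e.symm (𝓝 z) (𝓝 (e.symm z)) := e.continuousAt_symm (hrs (hb hz)).1
      have h1 : Tendsto (fun p : ι × E => e' (F p.1 (e.symm p.2))) (l ×ˢ 𝓝 z)
          (𝓝 (e' (g (e.symm z)))) :=
        (e'.continuousAt (hrs (hb hz)).2).tendsto.comp
          ((ContinuousMap.tendsto_prod_nhds h (e.symm z)).comp (tendsto_id.prodMap hez))
      have h2 : Tendsto (fun p : ι × E => e' (g (e.symm p.2))) (l ×ˢ 𝓝 z)
          (𝓝 (e' (g (e.symm z)))) :=
        (e'.continuousAt (hrs (hb hz)).2).tendsto.comp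
          ((g.continuous.tendsto _).comp (hez.comp tendsto_snd))
      exact (h2.prodMk_nhds h1).mono_right (nhds_le_uniformity _)
    · filter_upwards [hF, hev] with i hi hmaps z hz
      refine DifferentiableAt.differentiableWithinAt ?_
      rw [← mdifferentiableAt_iff_differentiableAt]
      exact MDifferentiableAt.comp (g := e') (f := fun z => F i (e.symm z)) z
        (mdifferentiableAt_atlas (chart_mem_atlas E' _) (hmaps ⟨z, hb hz, rfl⟩))
        (MDifferentiableAt.comp (g := F i) (f := e.symm) z (hi _)
          (mdifferentiableAt_atlas_symm (chart_mem_atlas E _) (hrs (hb hz)).1))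
  rw [mdifferentiableAt_iff]
  refine ⟨g.continuous.continuousAt, ?_⟩
  have := (hd.differentiableAt (Metric.ball_mem_nhds _ hr)).differentiableWithinAt (s := Set.univ)
  simpa [writtenInExtChartAt, Function.comp_def, extChartAt, ← he, ← he'] using this

end HolomorphicLimits

/-! ### Normality of the holomorphic self-maps of a taut manifold -/

section Normality

open Filter Set

variable {E : Type*} [NormedAddCommGroup E] [NormedSpace ℂ E] {X : Type*} [TopologicalSpace X]
  [ChartedSpace E X] [IsManifold 𝓘(ℂ, E) 1 X] [T2Space X]

section Equicontinuity

variable [LocallyCompactSpace X] {ι : Type*} {l : Filter ι} {F : ι → X → X}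

/-- On a hyperbolic manifold, a point with small Kobayashi distance to a convergent family
converges too. -/
lemma IsKobayashiHyperbolic.tendsto_of_tendsto_kobayashiDist
    (hX : IsKobayashiHyperbolic 𝓘(ℂ, E) X) {u v : ι → X} {p : X} (hu : Tendsto u l (𝓝 p))
    (huv : Tendsto (fun i => kobayashiDist 𝓘(ℂ, E) (u i) (v i)) l (𝓝 0)) : Tendsto v l (𝓝 p) := by
  intro U hU
  obtain ⟨ε, hε, h⟩ := hX.exists_pos_forall_lt_mem hU
  have h1 : Tendsto (fun i => kobayashiDist 𝓘(ℂ, E) p (u i) + kobayashiDist 𝓘(ℂ, E) (u i) (v i))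
      l (𝓝 0) := by
    simpa using ((tendsto_kobayashiDist_nhds_self p).comp hu).add huv
  rw [mem_map]
  filter_upwards [h1.eventually (gt_mem_nhds hε)] with i hi
  exact h _ ((kobayashiDist_triangle _ _ _).trans_lt hi)

/-- On a hyperbolic manifold, a point with small Kobayashi distance to a family that leaves every
compact set leaves every compact set. -/
lemma IsKobayashiHyperbolic.tendsto_cocompact_of_tendsto_kobayashiDist
    (hX : IsKobayashiHyperbolic 𝓘(ℂ, E) X) {u v : ι → X} (hu : Tendsto u l (cocompact X))
    (huv : Tendsto (fun i => kobayashiDist 𝓘(ℂ, E) (u i) (v i)) l (𝓝 0)) :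
    Tendsto v l (cocompact X) := by
  refine (hasBasis_cocompact.tendsto_right_iff).2 fun K hK => ?_
  obtain ⟨K', hK', hKK'⟩ := exists_compact_superset hK
  obtain ⟨ε, hε, h⟩ : ∃ ε : ℝ≥0∞, 0 < ε ∧ ∀ p ∈ K, ∀ q, kobayashiDist 𝓘(ℂ, E) p q < ε →
      q ∈ K' := by
    refine hK.induction_on (p := fun S => ∃ ε : ℝ≥0∞, 0 < ε ∧ ∀ p ∈ S, ∀ q,
      kobayashiDist 𝓘(ℂ, E) p q < ε → q ∈ K') ⟨1, one_pos, by simp⟩ ?_ ?_ ?_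
    · rintro s t hst ⟨ε, hε, h⟩
      exact ⟨ε, hε, fun z hz => h z (hst hz)⟩
    · rintro s t ⟨ε, hε, h⟩ ⟨ε', hε', h'⟩
      refine ⟨min ε ε', lt_min hε hε', ?_⟩
      rintro z (hz | hz) q hq
      · exact h z hz q (hq.trans_le (min_le_left _ _))
      · exact h' z hz q (hq.trans_le (min_le_right _ _))
    · intro p hp
      obtain ⟨ε, hε, h⟩ := hX.exists_pos_forall_lt_mem
        (mem_of_superset (isOpen_interior.mem_nhds (hKK' hp)) interior_subset)
      have hε2 : 0 < ε / 2 := ENNReal.half_pos hε.ne'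
      refine ⟨_, mem_nhdsWithin_of_mem_nhds
        ((tendsto_kobayashiDist_nhds_self (E := E) p).eventually (gt_mem_nhds hε2)), ε / 2, hε2,
        fun p' (hp' : kobayashiDist 𝓘(ℂ, E) p p' < ε / 2) q hq => h q ?_⟩
      calc _ ≤ _ := kobayashiDist_triangle p p' q
        _ < ε / 2 + ε / 2 := ENNReal.add_lt_add hp' hq
        _ = ε := ENNReal.add_halves _
  filter_upwards [hu.eventually hK'.compl_mem_cocompact, huv.eventually (gt_mem_nhds hε)]
    with i hi hlt hiK
  exact hi (h _ hiK _ (by rwa [kobayashiDist_comm]))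

/-- Holomorphic self-maps of a hyperbolic manifold are equicontinuous as maps into its one-point
compactification. -/
lemma IsKobayashiHyperbolic.tendsto_onePoint_prod_nhds (hX : IsKobayashiHyperbolic 𝓘(ℂ, E) X)
    (hF : ∀ᶠ i in l, MDifferentiable 𝓘(ℂ, E) 𝓘(ℂ, E) (F i)) {x : X} {p : OnePoint X}
    (h : Tendsto (fun i => (F i x : OnePoint X)) l (𝓝 p)) :
    Tendsto (fun q : ι × X => (F q.1 q.2 : OnePoint X)) (l ×ˢ 𝓝 x) (𝓝 p) := by
  have hk : Tendsto (fun q : ι × X => kobayashiDist 𝓘(ℂ, E) (F q.1 x) (F q.1 q.2))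
      (l ×ˢ 𝓝 x) (𝓝 0) := by
    refine tendsto_of_tendsto_of_tendsto_of_le_of_le' tendsto_const_nhds
      ((tendsto_kobayashiDist_nhds_self (E := E) x).comp tendsto_snd)
      (Eventually.of_forall fun _ => zero_le) ?_
    filter_upwards [tendsto_fst.eventually hF] with q hq
    exact kobayashiDist_map_le hq _ _
  induction p using OnePoint.rec with
  | infty =>
    have h1 : Tendsto (fun i => F i x) l (cocompact X) := by
      rw [← coclosedCompact_eq_cocompact, ← OnePoint.comap_coe_nhds_infty]
      exact tendsto_comap_iff.2 h
    have h2 := hX.tendsto_cocompact_of_tendsto_kobayashiDist (h1.comp tendsto_fst) hk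
    rw [← coclosedCompact_eq_cocompact, ← OnePoint.comap_coe_nhds_infty] at h2
    exact tendsto_comap_iff.1 h2
  | coe p =>
    have h1 : Tendsto (fun i => F i x) l (𝓝 p) :=
      (OnePoint.isOpenEmbedding_coe.tendsto_nhds_iff).2 h
    exact (OnePoint.continuous_coe.tendsto p).comp
      (hX.tendsto_of_tendsto_kobayashiDist (h1.comp tendsto_fst) hk)

end Equicontinuity

/-- A version of Montel's theorem: on a connected taut manifold, the holomorphic self-maps that
send a given point into a given compact set form a compact set. The limit along an ultrafilter
exists as a map into the one-point compactification; by tautness, along every disk the limit either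
stays in the manifold or is constantly `∞`, so the set where it is `∞` is open and closed. -/
theorem IsTaut.isCompact_setOf_mdifferentiable [ProperSpace E] [ConnectedSpace X]
    (hX : IsTaut 𝓘(ℂ, E) X) (x₀ : X) {K : Set X} (hK : IsCompact K) :
    IsCompact {g : C(X, X) | MDifferentiable 𝓘(ℂ, E) 𝓘(ℂ, E) g ∧ g x₀ ∈ K} := by
  have : LocallyCompactSpace X := ChartedSpace.locallyCompactSpace E X
  refine isCompact_iff_ultrafilter_le_nhds.2 fun 𝒰 h𝒰 => ?_
  have hmem : ∀ᶠ u : C(X, X) in (𝒰 : Filter C(X, X)),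
      MDifferentiable 𝓘(ℂ, E) 𝓘(ℂ, E) u ∧ u x₀ ∈ K :=
    le_principal_iff.1 h𝒰
  have hhol := hmem.mono fun u hu => hu.1
  -- the limit as a map into the one-point compactification
  have hlim : ∀ x, ∃ p : OnePoint X, Tendsto (fun u : C(X, X) => (u x : OnePoint X)) 𝒰 (𝓝 p) :=
    fun x => ⟨_, (𝒰.map fun u : C(X, X) => (u x : OnePoint X)).le_nhds_lim⟩
  choose G hG using hlim
  have hG' : ∀ x, Tendsto (fun q : C(X, X) × X => (q.1 q.2 : OnePoint X)) (𝒰 ×ˢ 𝓝 x) (𝓝 (G x)) :=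
    fun x => hX.1.tendsto_onePoint_prod_nhds (F := fun u : C(X, X) => u) hhol (hG x)
  have hGc : Continuous G := continuous_of_forall_tendsto_prod_nhds
    (F := fun (u : C(X, X)) (x : X) => (u x : OnePoint X)) hG'
  -- tautness along a disk
  have hdisk : ∀ φ : unitDisk → X, MDifferentiable 𝓘(ℂ) 𝓘(ℂ, E) φ → ∀ ζ₀ ζ₁,
      G (φ ζ₀) = OnePoint.infty → G (φ ζ₁) = OnePoint.infty := by
    intro φ hφ ζ₀ ζ₁ h0
    have hcl : (⟨G ∘ φ, hGc.comp hφ.continuous⟩ : C(unitDisk, OnePoint X)) ∈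
        closure (holDisksInOnePoint 𝓘(ℂ, E) X) := by
      refine mem_closure_of_tendsto (b := (𝒰 : Filter C(X, X)))
        (f := fun u => (⟨fun ζ => (u (φ ζ) : OnePoint X), OnePoint.continuous_coe.comp
          (u.continuous.comp hφ.continuous)⟩ : C(unitDisk, OnePoint X))) ?_ ?_
      · refine ContinuousMap.tendsto_of_forall_tendsto_prod_nhds fun ζ => ?_
        exact (hG' (φ ζ)).comp (tendsto_id.prodMap (hφ.continuous.tendsto ζ))
      · filter_upwards [hhol] with u hu
        exact ⟨u ∘ φ, hu.comp hφ, fun ζ => rfl⟩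
    rcases hX.2 _ hcl with ⟨ψ, -, hψ⟩ | hc
    · exact absurd ((hψ ζ₀).symm.trans h0) (OnePoint.coe_ne_infty _)
    · exact DFunLike.congr_fun hc ζ₁
  have hne : ∀ x, G x ≠ OnePoint.infty := by
    have hclopen : IsClopen {x | G x = OnePoint.infty} := by
      refine ⟨isClosed_eq hGc continuous_const, isOpen_iff_mem_nhds.2 fun x hx => ?_⟩
      filter_upwards [(tendsto_lempertFunction_nhds_self (E := E) x).eventually
        (gt_mem_nhds one_pos)] with y hy
      obtain ⟨φ, ζ₀, ζ₁, hφ, rfl, rfl, -⟩ := exists_disk_of_lempertFunction_lt hy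
      exact hdisk φ hφ _ _ hx
    rcases isClopen_iff.1 hclopen with h | h
    · exact fun x hx => (h ▸ hx : x ∈ (∅ : Set X))
    · have h0 : G x₀ = OnePoint.infty := (h ▸ mem_univ x₀ : x₀ ∈ {x | G x = OnePoint.infty})
      have hKc : IsClosed ((↑) '' K : Set (OnePoint X)) :=
        (hK.image OnePoint.continuous_coe).isClosed
      have := hKc.mem_of_tendsto (hG x₀) (hmem.mono fun u hu => mem_image_of_mem _ hu.2)
      rw [h0] at this
      exact absurd this (OnePoint.infty_notMem_image_coe)
  choose g hg using fun x => OnePoint.ne_infty_iff_exists.1 (hne x)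
  have hg' : ∀ x, Tendsto (fun q : C(X, X) × X => q.1 q.2) (𝒰 ×ˢ 𝓝 x) (𝓝 (g x)) := fun x =>
    (OnePoint.isOpenEmbedding_coe.tendsto_nhds_iff).2 (by
      rw [hg]; exact hG' x)
  have hgc : Continuous g := continuous_of_forall_tendsto_prod_nhds
    (F := fun (u : C(X, X)) (x : X) => u x) hg'
  have ht : Tendsto id (𝒰 : Filter C(X, X)) (𝓝 ⟨g, hgc⟩) :=
    ContinuousMap.tendsto_of_forall_tendsto_prod_nhds hg'
  refine ⟨⟨g, hgc⟩, ⟨MDifferentiable.of_tendsto ht hhol, ?_⟩, ht⟩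
  exact hK.isClosed.mem_of_tendsto (((continuous_eval_const x₀).tendsto _).comp ht)
    (hmem.mono fun u hu => hu.2)

end Normality

/-! ### The limit maps form an abelian group -/

section LimitMaps

open Filter Set

section Topological

variable {X : Type*} [TopologicalSpace X]

lemma iterateMap_add (f : C(X, X)) (k m : ℕ) :
    iterateMap f (k + m) = (iterateMap f k).comp (iterateMap f m) := by
  ext x
  exact Function.iterate_add_apply f k m x

lemma iterateMap_succ (f : C(X, X)) (k : ℕ) :
    iterateMap f (k + 1) = f.comp (iterateMap f k) := by
  ext x
  exact Function.iterate_succ_apply' f k x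

variable [LocallyCompactSpace X] {f : C(X, X)}

lemma Filter.Tendsto.continuousMap_comp {ι : Type*} {l : Filter ι} {F G : ι → C(X, X)}
    {g h : C(X, X)} (hF : Tendsto F l (𝓝 g)) (hG : Tendsto G l (𝓝 h)) :
    Tendsto (fun i => (F i).comp (G i)) l (𝓝 (g.comp h)) :=
  (ContinuousMap.continuous_comp'.tendsto (h, g)).comp (hG.prodMk_nhds hF)

lemma exists_strictMono_add_le {k m : ℕ → ℕ} (hk : StrictMono k) (hm : StrictMono m) :
    ∃ n : ℕ → ℕ, StrictMono n ∧ ∀ ν, m ν + ν ≤ k (n ν) :=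
  ⟨fun ν => m ν + ν, hm.add strictMono_id, fun ν => hk.id_le (m ν + ν)⟩

lemma comp_mem_limitMaps {g h : C(X, X)} (hg : g ∈ limitMaps f) (hh : h ∈ limitMaps f) :
    g.comp h ∈ limitMaps f := by
  obtain ⟨k, hk, hkg⟩ := hg
  obtain ⟨m, hm, hmh⟩ := hh
  refine ⟨fun ν => k ν + m ν, hk.add hm, ?_⟩
  simp only [iterateMap_add]
  exact hkg.continuousMap_comp hmh

lemma comp_comm_of_mem_limitMaps [T2Space X] {g h : C(X, X)} (hg : g ∈ limitMaps f)
    (hh : h ∈ limitMaps f) : g.comp h = h.comp g := by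
  obtain ⟨k, hk, hkg⟩ := hg
  obtain ⟨m, hm, hmh⟩ := hh
  refine tendsto_nhds_unique (hkg.continuousMap_comp hmh) ?_
  simp only [← iterateMap_add, add_comm (k _) (m _)]
  simp only [iterateMap_add]
  exact hmh.continuousMap_comp hkg

lemma comp_self_mem_limitMaps {g : C(X, X)} (hg : g ∈ limitMaps f) :
    f.comp g ∈ limitMaps f := by
  obtain ⟨k, hk, hkg⟩ := hg
  refine ⟨fun ν => k ν + 1, hk.add_const 1, ?_⟩
  simp only [iterateMap_succ]
  exact tendsto_const_nhds.continuousMap_comp hkg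

lemma mem_limitMaps_iff_mapClusterPt [SecondCountableTopology X] {g : C(X, X)} :
    g ∈ limitMaps f ↔ MapClusterPt g atTop (iterateMap f) := by
  constructor
  · rintro ⟨k, hk, h⟩
    exact (h.mapClusterPt).of_comp hk.tendsto_atTop
  · intro h
    obtain ⟨k, hk, hkg⟩ := h.tendsto_subseq
    exact ⟨k, hk, hkg⟩

lemma isClosed_limitMaps [SecondCountableTopology X] (f : C(X, X)) : IsClosed (limitMaps f) := by
  have : limitMaps f = {g | ClusterPt g (map (iterateMap f) atTop)} := by
    ext g
    exact mem_limitMaps_iff_mapClusterPt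
  rw [this]
  exact isClosed_setOfPred_clusterPt

end Topological

variable {E : Type*} [NormedAddCommGroup E] [NormedSpace ℂ E] {X : Type*} [TopologicalSpace X]
  [ChartedSpace E X] {f : C(X, X)}

lemma mdifferentiable_iterateMap (hf : MDifferentiable 𝓘(ℂ, E) 𝓘(ℂ, E) f) (k : ℕ) :
    MDifferentiable 𝓘(ℂ, E) 𝓘(ℂ, E) (iterateMap f k) := by
  induction k with
  | zero => exact mdifferentiable_id
  | succ k ih => rw [iterateMap_succ]; exact hf.comp ih

variable [IsManifold 𝓘(ℂ, E) 1 X] [ProperSpace E]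

lemma mdifferentiable_of_mem_limitMaps (hf : MDifferentiable 𝓘(ℂ, E) 𝓘(ℂ, E) f) {g : C(X, X)}
    (hg : g ∈ limitMaps f) : MDifferentiable 𝓘(ℂ, E) 𝓘(ℂ, E) g := by
  obtain ⟨k, -, hk⟩ := hg
  exact MDifferentiable.of_tendsto hk
    (Eventually.of_forall fun ν => mdifferentiable_iterateMap hf (k ν))

variable [T2Space X] [SecondCountableTopology X] [ConnectedSpace X]

/-- If the orbit of one point converges along a sequence of iterates of a holomorphic self-map of a
taut manifold, then that sequence has a limit map. -/
lemma IsTaut.exists_subseq_tendsto_of_tendsto (hX : IsTaut 𝓘(ℂ, E) X)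
    (hf : MDifferentiable 𝓘(ℂ, E) 𝓘(ℂ, E) f) {n : ℕ → ℕ} {x y : X}
    (h : Tendsto (fun ν => f^[n ν] x) atTop (𝓝 y)) :
    ∃ (g : C(X, X)) (σ : ℕ → ℕ), StrictMono σ ∧
      Tendsto (fun ν => iterateMap f (n (σ ν))) atTop (𝓝 g) := by
  have : LocallyCompactSpace X := ChartedSpace.locallyCompactSpace E X
  obtain ⟨K, hK, hKy⟩ := exists_compact_mem_nhds y
  have hev : ∀ᶠ ν in atTop, iterateMap f (n ν) ∈
      {g : C(X, X) | MDifferentiable 𝓘(ℂ, E) 𝓘(ℂ, E) g ∧ g x ∈ K} := by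
    filter_upwards [h.eventually hKy] with ν hν
    exact ⟨mdifferentiable_iterateMap hf _, hν⟩
  obtain ⟨g, -, σ, hσ, hg⟩ :=
    (hX.isCompact_setOf_mdifferentiable x hK).tendsto_subseq' hev.frequently
  exact ⟨g, σ, hσ, hg⟩

/-- If the iterates are not compactly divergent, there is a limit map. -/
lemma IsTaut.nonempty_limitMaps (hX : IsTaut 𝓘(ℂ, E) X)
    (hf : MDifferentiable 𝓘(ℂ, E) 𝓘(ℂ, E) f)
    (hdiv : ¬ IsCompactlyDivergent (fun k => iterateMap f k)) : (limitMaps f).Nonempty := by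
  have : LocallyCompactSpace X := ChartedSpace.locallyCompactSpace E X
  unfold IsCompactlyDivergent at hdiv
  push Not at hdiv
  obtain ⟨H, K, hH, hK, h⟩ := hdiv
  obtain ⟨n, hn, hnHK⟩ := extraction_of_frequently_atTop (frequently_atTop.2 h)
  choose z hz using fun ν => (hnHK ν : (iterateMap f (n ν) '' H ∩ K).Nonempty)
  choose p hp hpz using fun ν => (hz ν).1
  obtain ⟨⟨x, y⟩, -, σ, hσ, hlim⟩ := (hH.prod hK).tendsto_subseq
    (fun ν => (⟨hp ν, (hz ν).2⟩ : (p ν, z ν) ∈ H ×ˢ K))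
  rw [nhds_prod_eq] at hlim
  have hpx : Tendsto (fun ν => p (σ ν)) atTop (𝓝 x) := tendsto_fst.comp hlim
  have hzy : Tendsto (fun ν => z (σ ν)) atTop (𝓝 y) := tendsto_snd.comp hlim
  have hxy : Tendsto (fun ν => f^[n (σ ν)] x) atTop (𝓝 y) := by
    refine hX.1.tendsto_of_tendsto_kobayashiDist hzy ?_
    refine tendsto_of_tendsto_of_tendsto_of_le_of_le tendsto_const_nhds
      ((tendsto_kobayashiDist_nhds_self (E := E) x).comp hpx) (fun _ => zero_le) fun ν => ?_
    rw [← hpz, kobayashiDist_comm]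
    exact kobayashiDist_map_le (mdifferentiable_iterateMap hf _) _ _
  obtain ⟨g, τ, hτ, hg⟩ := hX.exists_subseq_tendsto_of_tendsto (n := n ∘ σ) hf hxy
  exact ⟨g, _, hn.comp (hσ.comp hτ), hg⟩

/-- Any limit map is divisible by any other: if `f^kᵥ → g` and `f^mᵥ → g'` with `kᵥ - mᵥ → ∞`, then
`f^(kᵥ - mᵥ)` has a limit map `h`, and `h ∘ g' = g`. -/
lemma IsTaut.exists_comp_eq_of_mem_limitMaps (hX : IsTaut 𝓘(ℂ, E) X)
    (hf : MDifferentiable 𝓘(ℂ, E) 𝓘(ℂ, E) f) {g g' : C(X, X)} (hg : g ∈ limitMaps f)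
    (hg' : g' ∈ limitMaps f) : ∃ h ∈ limitMaps f, h.comp g' = g := by
  have : LocallyCompactSpace X := ChartedSpace.locallyCompactSpace E X
  obtain ⟨k, hk, hkg⟩ := hg
  obtain ⟨m, hm, hmg⟩ := hg'
  -- pass to a subsequence along which the differences of the exponents tend to infinity
  obtain ⟨n, hn, hmn⟩ := exists_strictMono_add_le hk hm
  have hkng := hkg.comp hn.tendsto_atTop
  have hsplit : ∀ ν, iterateMap f (k (n ν)) =
      (iterateMap f (k (n ν) - m ν)).comp (iterateMap f (m ν)) := fun ν => by
    rw [← iterateMap_add, Nat.sub_add_cancel (by linarith [hmn ν])]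
  obtain ⟨x⟩ : Nonempty X := inferInstance
  have hpt : ∀ {F : ℕ → C(X, X)} {G : C(X, X)}, Tendsto F atTop (𝓝 G) →
      Tendsto (fun ν => F ν x) atTop (𝓝 (G x)) := fun h =>
    ((continuous_eval_const x).tendsto _).comp h
  have horb : Tendsto (fun ν => f^[k (n ν) - m ν] (g' x)) atTop (𝓝 (g x)) := by
    refine hX.1.tendsto_of_tendsto_kobayashiDist (hpt hkng) ?_
    refine tendsto_of_tendsto_of_tendsto_of_le_of_le tendsto_const_nhds
      ((tendsto_kobayashiDist_nhds_self (E := E) (g' x)).comp (hpt hmg)) (fun _ => zero_le)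
      fun ν => ?_
    simp only [Function.comp_apply, hsplit]
    rw [kobayashiDist_comm]
    exact kobayashiDist_map_le (mdifferentiable_iterateMap hf _) _ _
  obtain ⟨h, σ, hσ, hh⟩ := hX.exists_subseq_tendsto_of_tendsto hf horb
  refine ⟨h, ?_, ?_⟩
  · refine mem_limitMaps_iff_mapClusterPt.2 (hh.mapClusterPt.of_comp ?_)
    refine tendsto_atTop_mono (fun ν => ?_) hσ.tendsto_atTop
    have := hmn (σ ν)
    omega
  · refine tendsto_nhds_unique (hh.continuousMap_comp (hmg.comp hσ.tendsto_atTop)) ?_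
    simp only [Function.comp_apply, ← hsplit]
    exact hkng.comp hσ.tendsto_atTop

/-- The limit maps form an abelian group under composition: they are a nonempty commutative
semigroup in which division is always possible. -/
theorem IsTaut.exists_unit_limitMaps (hX : IsTaut 𝓘(ℂ, E) X)
    (hf : MDifferentiable 𝓘(ℂ, E) 𝓘(ℂ, E) f)
    (hdiv : ¬ IsCompactlyDivergent (fun k => iterateMap f k)) :
    ∃ ρ ∈ limitMaps f, (∀ h ∈ limitMaps f, ρ.comp h = h) ∧
      ∀ h ∈ limitMaps f, ∃ h' ∈ limitMaps f, h'.comp h = ρ := by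
  have : LocallyCompactSpace X := ChartedSpace.locallyCompactSpace E X
  obtain ⟨g, hg⟩ := hX.nonempty_limitMaps hf hdiv
  obtain ⟨ρ, hρ, hρg⟩ := hX.exists_comp_eq_of_mem_limitMaps hf hg hg
  refine ⟨ρ, hρ, fun h hh => ?_, fun h hh => hX.exists_comp_eq_of_mem_limitMaps hf hρ hh⟩
  obtain ⟨q, hq, rfl⟩ := hX.exists_comp_eq_of_mem_limitMaps hf hh hg
  rw [← ContinuousMap.comp_assoc, comp_comm_of_mem_limitMaps hρ hq, ContinuousMap.comp_assoc, hρg]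

end LimitMaps

/-! ### The image of a holomorphic retraction -/

section HolomorphicSmooth

open Set

variable {E : Type*} [NormedAddCommGroup E] [NormedSpace ℂ E] {X : Type*} [TopologicalSpace X]
  [ChartedSpace E X] [IsManifold 𝓘(ℂ, E) 1 X]
  {E' : Type*} [NormedAddCommGroup E'] [NormedSpace ℂ E'] {Y : Type*} [TopologicalSpace Y]
  [ChartedSpace E' Y] [IsManifold 𝓘(ℂ, E') 1 Y]

/-- A holomorphic map on an open subset of a finite-dimensional complex manifold is continuously
differentiable. -/
lemma MDifferentiableOn.contMDiffOn_one_of_properSpace [ProperSpace E] {f : X → Y} {s : Set X}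
    (hs : IsOpen s) (hf : MDifferentiableOn 𝓘(ℂ, E) 𝓘(ℂ, E') f s) :
    ContMDiffOn 𝓘(ℂ, E) 𝓘(ℂ, E') 1 f s := by
  intro x hx
  refine ContMDiffAt.contMDiffWithinAt ?_
  set e := chartAt E x with he
  set e' := chartAt E' (f x) with he'
  have hxe : x ∈ e.source := mem_chart_source E x
  have hat : ∀ y ∈ s, MDifferentiableAt 𝓘(ℂ, E) 𝓘(ℂ, E') f y := fun y hy =>
    (hf y hy).mdifferentiableAt (hs.mem_nhds hy)
  have ho : IsOpen (e.target ∩ e.symm ⁻¹' (s ∩ f ⁻¹' e'.source)) :=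
    e.isOpen_inter_preimage_symm (hf.continuousOn.isOpen_inter_preimage hs e'.open_source)
  have hd : DifferentiableOn ℂ (e' ∘ f ∘ e.symm) (e.target ∩ e.symm ⁻¹' (s ∩ f ⁻¹' e'.source)) := by
    rintro z ⟨hz, hzs, hzf⟩
    refine DifferentiableAt.differentiableWithinAt ?_
    rw [← mdifferentiableAt_iff_differentiableAt]
    exact MDifferentiableAt.comp z (mdifferentiableAt_atlas (chart_mem_atlas E' _) hzf)
      (MDifferentiableAt.comp z (hat _ hzs) (mdifferentiableAt_atlas_symm (chart_mem_atlas E _) hz))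
  have hmem : e x ∈ e.target ∩ e.symm ⁻¹' (s ∩ f ⁻¹' e'.source) := by
    refine ⟨e.map_source hxe, ?_⟩
    rw [mem_preimage, e.left_inv hxe]
    exact ⟨hx, mem_chart_source E' (f x)⟩
  rw [contMDiffAt_iff]
  refine ⟨(hat x hx).continuousAt, ?_⟩
  have := ((hd.contDiffOn_one_of_properSpace ho).contDiffAt (ho.mem_nhds hmem)).contDiffWithinAt
    (s := univ)
  simpa [extChartAt, ← he, ← he'] using this

lemma OpenPartialHomeomorph.mem_maximalAtlas_of_mdifferentiableOn [ProperSpace E]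
    {e : OpenPartialHomeomorph X E} (he : MDifferentiableOn 𝓘(ℂ, E) 𝓘(ℂ, E) e e.source)
    (he' : MDifferentiableOn 𝓘(ℂ, E) 𝓘(ℂ, E) e.symm e.target) :
    e ∈ IsManifold.maximalAtlas 𝓘(ℂ, E) 1 X :=
  (IsManifold.mem_maximalAtlas_iff_contMDiffOn e).2
    ⟨he.contMDiffOn_one_of_properSpace e.open_source,
      he'.contMDiffOn_one_of_properSpace e.open_target⟩

end HolomorphicSmooth

section Linearization

open Set Filter

variable {E : Type*} [NormedAddCommGroup E] [NormedSpace ℂ E]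

/-- The holomorphic inverse function theorem, with an inverse that is differentiable on its whole
domain. -/
lemma exists_openPartialHomeomorph_differentiableOn [ProperSpace E] {ψ : E → E} {s : Set E}
    (hs : IsOpen s) (hψ : DifferentiableOn ℂ ψ s) {a : E} (ha : a ∈ s)
    (hψa : HasFDerivAt ψ (ContinuousLinearMap.id ℂ E) a) :
    ∃ Φ : OpenPartialHomeomorph E E, ⇑Φ = ψ ∧ a ∈ Φ.source ∧ Φ.source ⊆ s ∧
      DifferentiableOn ℂ Φ.symm Φ.target := by
  have hc := hψ.contDiffOn_one_of_properSpace hs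
  set Φ₀ := (hc.contDiffAt (hs.mem_nhds ha)).toOpenPartialHomeomorph ψ
    (f' := ContinuousLinearEquiv.refl ℂ E) hψa one_ne_zero with hΦ₀
  have hΦ₀c : ⇑Φ₀ = ψ := rfl
  have ha₀ : a ∈ Φ₀.source := ContDiffAt.mem_toOpenPartialHomeomorph_source _ _ _
  set V := s ∩ fderiv ℂ ψ ⁻¹' range ((↑) : (E ≃L[ℂ] E) → E →L[ℂ] E) with hV
  have hVo : IsOpen V := (hc.continuousOn_fderiv_of_isOpen hs le_rfl).isOpen_inter_preimage hs
    ContinuousLinearEquiv.isOpen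
  have haV : a ∈ V := ⟨ha, ContinuousLinearEquiv.refl ℂ E, hψa.fderiv.symm⟩
  refine ⟨Φ₀.restrOpen V hVo, hΦ₀c, ⟨ha₀, haV⟩, fun z hz => hz.2.1, fun w hw => ?_⟩
  obtain ⟨hws, A, hA⟩ := ((Φ₀.restrOpen V hVo).map_target hw).2
  have hd : HasFDerivAt (Φ₀.restrOpen V hVo) (A : E →L[ℂ] E) ((Φ₀.restrOpen V hVo).symm w) := by
    rw [hA]
    exact (hψ.differentiableAt (hs.mem_nhds hws)).hasFDerivAt
  exact ((Φ₀.restrOpen V hVo).hasFDerivAt_symm hw hd).differentiableAt.differentiableWithinAt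

variable {X : Type*} [TopologicalSpace X] [ChartedSpace E X]

/-- A chart of `X` in which the retraction `ρ` is the linear projection `P`. -/
structure IsLinearizingChart (ρ : X → X) (P : E →L[ℂ] E) (e : OpenPartialHomeomorph X E) :
    Prop where
  mem_maximalAtlas : e ∈ IsManifold.maximalAtlas 𝓘(ℂ, E) 1 X
  mapsTo : MapsTo ρ e.source e.source
  apply_map : ∀ z ∈ e.source, e (ρ z) = P (e z)

/-- Conjugate endomorphisms have the same rank. -/
lemma finrank_range_eq_of_conj {P P' S T : E →L[ℂ] E} (hST : S.comp T = ContinuousLinearMap.id ℂ E)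
    (hTS : T.comp S = ContinuousLinearMap.id ℂ E) (hTP : T.comp P = P'.comp T) :
    Module.finrank ℂ (LinearMap.range (P : E →ₗ[ℂ] E)) =
      Module.finrank ℂ (LinearMap.range (P' : E →ₗ[ℂ] E)) := by
  have hTinj : Function.Injective (T : E →ₗ[ℂ] E) :=
    Function.LeftInverse.injective (g := S) fun v => DFunLike.congr_fun hST v
  have hTsurj : Function.Surjective (T : E →ₗ[ℂ] E) :=
    Function.RightInverse.surjective (g := S) fun v => DFunLike.congr_fun hTS v
  have h : (T : E →ₗ[ℂ] E) ∘ₗ (P : E →ₗ[ℂ] E) = (P' : E →ₗ[ℂ] E) ∘ₗ (T : E →ₗ[ℂ] E) :=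
    LinearMap.ext fun v => DFunLike.congr_fun hTP v
  rw [(Submodule.equivMapOfInjective _ hTinj (LinearMap.range (P : E →ₗ[ℂ] E))).finrank_eq,
    ← LinearMap.range_comp, h, LinearMap.range_comp_of_range_eq_top _
      (LinearMap.range_eq_top.2 hTsurj)]

/-- A change of linearizing charts `τ` intertwines the two projections. -/
lemma IsLinearizingChart.transition {ρ : X → X} {P P' : E →L[ℂ] E}
    {e e' : OpenPartialHomeomorph X E} (h : IsLinearizingChart ρ P e)
    (h' : IsLinearizingChart ρ P' e') {q : X} (hqe : q ∈ e.source) (hqe' : q ∈ e'.source) :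
    DifferentiableAt ℂ (e' ∘ e.symm) (e q) ∧
      (e' ∘ e.symm) ∘ P =ᶠ[𝓝 (e q)] P' ∘ (e' ∘ e.symm) ∧
      (e ∘ e'.symm) ∘ (e' ∘ e.symm) =ᶠ[𝓝 (e q)] id := by
  have hnhds : e.target ∩ e.symm ⁻¹' e'.source ∈ 𝓝 (e q) :=
    (e.isOpen_inter_preimage_symm e'.open_source).mem_nhds
      ⟨e.map_source hqe, by rwa [mem_preimage, e.left_inv hqe]⟩
  refine ⟨?_, ?_, ?_⟩
  · rw [← mdifferentiableAt_iff_differentiableAt]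
    refine MDifferentiableAt.comp (e q) ?_
      ((contMDiffAt_symm_of_mem_maximalAtlas h.mem_maximalAtlas
        (e.map_source hqe)).mdifferentiableAt one_ne_zero)
    rw [e.left_inv hqe]
    exact (contMDiffAt_of_mem_maximalAtlas h'.mem_maximalAtlas hqe').mdifferentiableAt one_ne_zero
  · filter_upwards [hnhds] with u hu
    have hus := e.map_target hu.1
    have h1 := h.apply_map _ hus
    rw [e.right_inv hu.1] at h1
    simp only [Function.comp_apply]
    rw [← h1, e.left_inv (h.mapsTo hus), h'.apply_map _ hu.2]
  · filter_upwards [hnhds] with u hu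
    simp only [Function.comp_apply, id]
    rw [e'.left_inv hu.2, e.right_inv hu.1]

/-- The rank of a linearization is the same in all linearizing charts at a fixed point, since two of
them are conjugate by the derivative of the change of charts. -/
lemma IsLinearizingChart.finrank_range_eq {ρ : X → X} {P P' : E →L[ℂ] E}
    {e e' : OpenPartialHomeomorph X E} (h : IsLinearizingChart ρ P e)
    (h' : IsLinearizingChart ρ P' e') {q : X} (hq : ρ q = q) (hqe : q ∈ e.source)
    (hqe' : q ∈ e'.source) :
    Module.finrank ℂ (LinearMap.range (P : E →ₗ[ℂ] E)) =
      Module.finrank ℂ (LinearMap.range (P' : E →ₗ[ℂ] E)) := by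
  have hPa : P (e q) = e q := by rw [← h.apply_map q hqe, hq]
  obtain ⟨hτ, hint, hinv⟩ := h.transition h' hqe hqe'
  obtain ⟨hσ, -, hinv'⟩ := h'.transition h hqe' hqe
  have hτa : (e' ∘ e.symm) (e q) = e' q := by simp [e.left_inv hqe]
  have hσa : (e ∘ e'.symm) (e' q) = e q := by simp [e'.left_inv hqe']
  have hτ' := hτ.hasFDerivAt
  have hσ' := hσ.hasFDerivAt
  generalize fderiv ℂ (e' ∘ e.symm) (e q) = T at hτ'
  generalize fderiv ℂ (e ∘ e'.symm) (e' q) = S at hσ'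
  have hST : S.comp T = ContinuousLinearMap.id ℂ E := by
    have h1 : HasFDerivAt ((e ∘ e'.symm) ∘ (e' ∘ e.symm)) (S.comp T) (e q) :=
      HasFDerivAt.comp (e q) (by rw [hτa]; exact hσ') hτ'
    exact h1.unique ((hasFDerivAt_id _).congr_of_eventuallyEq hinv)
  have hTS : T.comp S = ContinuousLinearMap.id ℂ E := by
    have h1 : HasFDerivAt ((e' ∘ e.symm) ∘ (e ∘ e'.symm)) (T.comp S) (e' q) :=
      HasFDerivAt.comp (e' q) (by rw [hσa]; exact hτ') hσ'
    exact h1.unique ((hasFDerivAt_id _).congr_of_eventuallyEq hinv')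
  have hTP : T.comp P = P'.comp T := by
    have h1 : HasFDerivAt ((e' ∘ e.symm) ∘ P) (T.comp P) (e q) :=
      HasFDerivAt.comp (e q) (by rw [hPa]; exact hτ') P.hasFDerivAt
    have h2 : HasFDerivAt (P' ∘ (e' ∘ e.symm)) (P'.comp T) (e q) :=
      HasFDerivAt.comp (e q) P'.hasFDerivAt hτ'
    exact h1.unique (h2.congr_of_eventuallyEq hint)
  exact finrank_range_eq_of_conj hST hTS hTP

variable [IsManifold 𝓘(ℂ, E) 1 X]

/-- Cartan's linearization of a holomorphic retraction `ρ` at a fixed point: if `r` is `ρ` in a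
chart and `P` its derivative at the fixed point, then `ψ = 1 - r + P ∘ (2 r - 1)` has derivative `1`
there and `ψ ∘ r = P ∘ ψ`. -/
lemma exists_isLinearizingChart [ProperSpace E] {ρ : X → X}
    (hρ : MDifferentiable 𝓘(ℂ, E) 𝓘(ℂ, E) ρ) (hρρ : ∀ z, ρ (ρ z) = ρ z) {p : X} (hp : ρ p = p) :
    ∃ (P : E →L[ℂ] E) (e : OpenPartialHomeomorph X E), (∀ v, P (P v) = P v) ∧ p ∈ e.source ∧
      IsLinearizingChart ρ P e := by
  set c := chartAt E p with hc
  have hpc : p ∈ c.source := mem_chart_source E p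
  set s := c.target ∩ c.symm ⁻¹' (ρ ⁻¹' c.source) with hs
  have hso : IsOpen s :=
    c.isOpen_inter_preimage_symm (c.open_source.preimage hρ.continuous)
  set a := c p with ha
  have has : a ∈ s := ⟨c.map_source hpc, by
    rw [mem_preimage, mem_preimage, c.left_inv hpc, hp]; exact hpc⟩
  set r : E → E := fun u => c (ρ (c.symm u)) with hr
  have hrd : DifferentiableOn ℂ r s := by
    rintro u ⟨hu, hu'⟩
    refine DifferentiableAt.differentiableWithinAt ?_
    rw [← mdifferentiableAt_iff_differentiableAt]
    exact MDifferentiableAt.comp (g := c) (f := fun z => ρ (c.symm z)) u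
      (mdifferentiableAt_atlas (chart_mem_atlas E _) hu')
      (MDifferentiableAt.comp (g := ρ) (f := c.symm) u (hρ _)
        (mdifferentiableAt_atlas_symm (chart_mem_atlas E _) hu))
  have hra : r a = a := by simp only [hr, ha, c.left_inv hpc, hp]
  have hrr : ∀ u ∈ s, r (r u) = r u := fun u hu => by
    simp only [hr, c.left_inv hu.2, hρρ]
  set P := fderiv ℂ r a with hP
  have hrP : HasFDerivAt r P a := (hrd.differentiableAt (hso.mem_nhds has)).hasFDerivAt
  have hPP : P.comp P = P := by
    have h1 : HasFDerivAt (r ∘ r) (P.comp P) a := HasFDerivAt.comp a (hra.symm ▸ hrP) hrP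
    have h2 : r ∘ r =ᶠ[𝓝 a] r := by
      filter_upwards [hso.mem_nhds has] with u hu using hrr u hu
    exact h1.unique (hrP.congr_of_eventuallyEq h2)
  have hPP' : ∀ v, P (P v) = P v := fun v => DFunLike.congr_fun hPP v
  set ψ : E → E := fun u => u - r u + P ((2 : ℂ) • r u - u) with hψ
  have hψd : DifferentiableOn ℂ ψ s := (differentiableOn_id.sub hrd).add
    (P.differentiable.comp_differentiableOn ((hrd.const_smul (2 : ℂ)).sub differentiableOn_id))
  have hψa : HasFDerivAt ψ (ContinuousLinearMap.id ℂ E) a := by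
    have h := ((hasFDerivAt_id a).sub hrP).add
      (P.hasFDerivAt.comp a ((hrP.const_smul (2 : ℂ)).sub (hasFDerivAt_id a)))
    refine h.congr_fderiv ?_
    ext v
    simp [hPP', two_smul]
  obtain ⟨Φ, hΦ, haΦ, hΦs, hΦd⟩ := exists_openPartialHomeomorph_differentiableOn hso hψd has hψa
  -- the chart, on the open set of points that `ρ` keeps in its domain
  set e₀ := c.trans Φ with he₀
  set U := ρ ⁻¹' e₀.source with hU
  have hUo : IsOpen U := e₀.open_source.preimage hρ.continuous
  have hpe₀ : p ∈ e₀.source := by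
    rw [he₀, OpenPartialHomeomorph.trans_source]
    exact ⟨hpc, haΦ⟩
  refine ⟨P, e₀.restrOpen U hUo, hPP', ⟨hpe₀, by rwa [hU, mem_preimage, hp]⟩, ?_, ?_, ?_⟩
  · have hsrc : ∀ z ∈ (e₀.restrOpen U hUo).source, z ∈ c.source ∧ c z ∈ Φ.source := fun z hz => by
      have := hz.1
      rwa [he₀, OpenPartialHomeomorph.trans_source] at this
    have htgt : ∀ w ∈ (e₀.restrOpen U hUo).target, w ∈ Φ.target ∧ Φ.symm w ∈ c.target :=
      fun w hw => by
        have := hw.1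
        rwa [he₀, OpenPartialHomeomorph.trans_target] at this
    refine OpenPartialHomeomorph.mem_maximalAtlas_of_mdifferentiableOn (fun z hz => ?_)
      fun w hw => ?_
    · refine MDifferentiableAt.mdifferentiableWithinAt ?_
      refine MDifferentiableAt.comp (g := Φ) (f := c) z ?_
        (mdifferentiableAt_atlas (chart_mem_atlas E _) (hsrc z hz).1)
      rw [mdifferentiableAt_iff_differentiableAt, hΦ]
      exact hψd.differentiableAt (hso.mem_nhds (hΦs (hsrc z hz).2))
    · refine MDifferentiableAt.mdifferentiableWithinAt ?_
      refine MDifferentiableAt.comp (g := c.symm) (f := Φ.symm) w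
        (mdifferentiableAt_atlas_symm (chart_mem_atlas E _) (htgt w hw).2) ?_
      rw [mdifferentiableAt_iff_differentiableAt]
      exact hΦd.differentiableAt (Φ.open_target.mem_nhds (htgt w hw).1)
  · intro z hz
    refine ⟨hz.2, ?_⟩
    rw [hU, mem_preimage, hρρ]
    exact hz.2
  · intro z hz
    have hz' : z ∈ c.source ∧ c z ∈ Φ.source := by
      have := hz.1
      rwa [he₀, OpenPartialHomeomorph.trans_source] at this
    have hru : r (c z) = c (ρ z) := by simp only [hr, c.left_inv hz'.1]
    have hrru : r (c (ρ z)) = c (ρ z) := by rw [← hru, hrr _ (hΦs hz'.2)]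
    change Φ (c (ρ z)) = P (Φ (c z))
    rw [hΦ]
    simp only [hψ, hrru, hru, two_smul, map_add, map_sub, hPP']
    abel_nf

end Linearization

section SubmanifoldStructure

open Set Filter

variable {A B E : Type*} [NormedAddCommGroup A] [NormedSpace ℂ A] [NormedAddCommGroup B]
  [NormedSpace ℂ B] [NormedAddCommGroup E] [NormedSpace ℂ E]

/-- The projection of `E` onto the image of the first factor, for a decomposition `E ≃ A × B`. -/
noncomputable def firstProjection (L : (A × B) ≃L[ℂ] E) : E →L[ℂ] E :=
  (L : (A × B) →L[ℂ] E) ∘L ContinuousLinearMap.inl ℂ A B ∘L ContinuousLinearMap.fst ℂ A B ∘L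
    (L.symm : E →L[ℂ] A × B)

lemma firstProjection_apply (L : (A × B) ≃L[ℂ] E) (v : E) :
    firstProjection L v = L ((L.symm v).1, 0) := rfl

/-- Every projection of rank `d` on an `n`-dimensional space is a `firstProjection`. -/
lemma exists_eq_firstProjection [FiniteDimensional ℂ E] {P : E →L[ℂ] E} (hP : ∀ v, P (P v) = P v)
    {d n : ℕ} (hd : Module.finrank ℂ (LinearMap.range (P : E →ₗ[ℂ] E)) = d)
    (hn : Module.finrank ℂ E = n) :
    ∃ L : (ComplexSpace d × ComplexSpace (n - d)) ≃L[ℂ] E, P = firstProjection L := by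
  have hc : IsCompl (LinearMap.range (P : E →ₗ[ℂ] E)) (LinearMap.ker (P : E →ₗ[ℂ] E)) :=
    LinearMap.IsIdempotentElem.isCompl (f := (P : E →ₗ[ℂ] E)) (LinearMap.ext hP)
  have hk : Module.finrank ℂ (LinearMap.ker (P : E →ₗ[ℂ] E)) = n - d := by
    have := LinearMap.finrank_range_add_finrank_ker (P : E →ₗ[ℂ] E)
    omega
  let eA : ComplexSpace d ≃ₗ[ℂ] LinearMap.range (P : E →ₗ[ℂ] E) :=
    LinearEquiv.ofFinrankEq _ _ (by rw [hd]; simp)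
  let eB : ComplexSpace (n - d) ≃ₗ[ℂ] LinearMap.ker (P : E →ₗ[ℂ] E) :=
    LinearEquiv.ofFinrankEq _ _ (by rw [hk]; simp)
  let L := ((eA.prodCongr eB).trans (Submodule.prodEquivOfIsCompl _ _ hc)).toContinuousLinearEquiv
  refine ⟨L, ContinuousLinearMap.ext fun v => ?_⟩
  obtain ⟨⟨a, b⟩, rfl⟩ := L.surjective v
  rw [firstProjection_apply, L.symm_apply_apply]
  have hL : ∀ a b, L (a, b) = (eA a : E) + (eB b : E) := fun a b => by simp [L]
  have hb : P (eB b : E) = 0 := (eB b).2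
  obtain ⟨w, hw⟩ := (eA a).2
  have ha : P (eA a : E) = eA a := by
    rw [← hw]; exact hP w
  simp only [hL, map_add, ha, hb, map_zero, Submodule.coe_zero]

variable {X : Type*} [TopologicalSpace X] [ChartedSpace E X]

/-- The chart induced on the image of a retraction by a linearizing chart: its first component. -/
noncomputable def IsLinearizingChart.imageChart {ρ : X → X} (hρ : Continuous ρ)
    (hρρ : ∀ z, ρ (ρ z) = ρ z) {L : (A × B) ≃L[ℂ] E} {e : OpenPartialHomeomorph X E}
    (h : IsLinearizingChart ρ (firstProjection L) e) : OpenPartialHomeomorph (range ρ) A where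
  toFun z := (L.symm (e z)).1
  invFun u := rangeFactorization ρ (e.symm (L (u, 0)))
  source := Subtype.val ⁻¹' e.source
  target := {u | L (u, 0) ∈ e.target}
  map_source' := by
    rintro ⟨_, w, rfl⟩ hz
    have h1 := h.apply_map _ hz
    rw [firstProjection_apply, hρρ] at h1
    change L _ ∈ e.target
    rw [← h1]
    exact e.map_source hz
  map_target' := fun u hu => h.mapsTo (e.map_target hu)
  left_inv' := by
    rintro ⟨_, w, rfl⟩ hz
    have h1 := h.apply_map _ hz
    rw [firstProjection_apply, hρρ] at h1
    refine Subtype.ext ?_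
    change ρ (e.symm (L _)) = ρ w
    rw [← h1, e.left_inv hz, hρρ]
  right_inv' := fun u hu => by
    change (L.symm (e (ρ (e.symm (L (u, 0)))))).1 = u
    rw [h.apply_map _ (e.map_target hu), e.right_inv hu, firstProjection_apply]
    simp
  open_source := e.open_source.preimage continuous_subtype_val
  open_target := e.open_target.preimage (by fun_prop)
  continuousOn_toFun := by
    have h1 : ContinuousOn (fun z : range ρ => e z) (Subtype.val ⁻¹' e.source) :=
      e.continuousOn.comp continuous_subtype_val.continuousOn fun z hz => hz
    exact (continuous_fst.comp L.symm.continuous).comp_continuousOn h1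
  continuousOn_invFun := by
    have h1 : ContinuousOn (fun u : A => e.symm (L (u, 0))) {u | L (u, 0) ∈ e.target} :=
      e.continuousOn_symm.comp (by fun_prop) fun u hu => hu
    exact hρ.rangeFactorization.comp_continuousOn h1

/-- In the induced chart and the linearizing chart, the inclusion of the image is `u ↦ (u, 0)`. -/
lemma IsLinearizingChart.map_imageChart_symm {ρ : X → X} (hρ : Continuous ρ)
    (hρρ : ∀ z, ρ (ρ z) = ρ z) {L : (A × B) ≃L[ℂ] E} {e : OpenPartialHomeomorph X E}
    (h : IsLinearizingChart ρ (firstProjection L) e) {u : A}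
    (hu : u ∈ (h.imageChart hρ hρρ).target) :
    e ((h.imageChart hρ hρρ).symm u : X) = L (u, 0) := by
  change e (ρ (e.symm (L (u, 0)))) = L (u, 0)
  rw [h.apply_map _ (e.map_target hu), e.right_inv hu, firstProjection_apply]
  simp

/-- The atlas on the image of a retraction made of the charts induced by a family of linearizing
charts. -/
@[reducible] noncomputable def imageChartedSpace {ρ : X → X} (hρ : Continuous ρ)
    (hρρ : ∀ z, ρ (ρ z) = ρ z) {L : range ρ → (A × B) ≃L[ℂ] E}
    {e : range ρ → OpenPartialHomeomorph X E}
    (h : ∀ q, IsLinearizingChart ρ (firstProjection (L q)) (e q))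
    (he : ∀ q : range ρ, (q : X) ∈ (e q).source) : ChartedSpace A (range ρ) where
  atlas := range fun q => (h q).imageChart hρ hρρ
  chartAt q := (h q).imageChart hρ hρρ
  mem_chart_source q := he q
  chart_mem_atlas q := mem_range_self q

variable {ρ : X → X} {L : range ρ → (A × B) ≃L[ℂ] E} {e : range ρ → OpenPartialHomeomorph X E}

lemma isManifold_imageChartedSpace [ProperSpace A] [IsManifold 𝓘(ℂ, E) 1 X]
    (hρ : MDifferentiable 𝓘(ℂ, E) 𝓘(ℂ, E) ρ)
    (hρρ : ∀ z, ρ (ρ z) = ρ z) (h : ∀ q, IsLinearizingChart ρ (firstProjection (L q)) (e q))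
    (he : ∀ q : range ρ, (q : X) ∈ (e q).source) :
    letI := imageChartedSpace hρ.continuous hρρ h he
    IsManifold 𝓘(ℂ, A) 1 (range ρ) := by
  let _ := imageChartedSpace hρ.continuous hρρ h he
  refine isManifold_of_contDiffOn 𝓘(ℂ, A) 1 (range ρ) ?_
  rintro _ _ ⟨q, rfl⟩ ⟨q', rfl⟩
  set c := (h q).imageChart hρ.continuous hρρ with hc
  set c' := (h q').imageChart hρ.continuous hρρ with hc'
  simp only [modelWithCornersSelf_coe, modelWithCornersSelf_coe_symm, Function.id_comp,
    Function.comp_id, preimage_id_eq, range_id, inter_univ, id]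
  refine DifferentiableOn.contDiffOn_one_of_properSpace (c.symm ≫ₕ c').open_source fun u hu => ?_
  rw [OpenPartialHomeomorph.trans_source] at hu
  refine DifferentiableAt.differentiableWithinAt ?_
  have hd : DifferentiableAt ℂ (fun u : A => e q' (ρ ((e q).symm (L q (u, 0))))) u := by
    rw [← mdifferentiableAt_iff_differentiableAt]
    refine MDifferentiableAt.comp (g := e q') (f := fun u => ρ ((e q).symm (L q (u, 0)))) u
      ((contMDiffAt_of_mem_maximalAtlas (h q').mem_maximalAtlas hu.2).mdifferentiableAt
        one_ne_zero) (MDifferentiableAt.comp (g := ρ) u (hρ _) ?_)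
    refine MDifferentiableAt.comp (g := (e q).symm) (f := fun u => L q (u, 0)) u
      ((contMDiffAt_symm_of_mem_maximalAtlas (h q).mem_maximalAtlas hu.1).mdifferentiableAt
        one_ne_zero) ?_
    rw [mdifferentiableAt_iff_differentiableAt]
    fun_prop
  exact (((L q').symm.differentiable _).comp u hd).fst

lemma isSmoothEmbedding_imageChartedSpace [ProperSpace A] [IsManifold 𝓘(ℂ, E) 1 X]
    (hρ : MDifferentiable 𝓘(ℂ, E) 𝓘(ℂ, E) ρ)
    (hρρ : ∀ z, ρ (ρ z) = ρ z) (h : ∀ q, IsLinearizingChart ρ (firstProjection (L q)) (e q))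
    (he : ∀ q : range ρ, (q : X) ∈ (e q).source) :
    letI := imageChartedSpace hρ.continuous hρρ h he
    Manifold.IsSmoothEmbedding 𝓘(ℂ, A) 𝓘(ℂ, E) 1 (Subtype.val : range ρ → X) := by
  let _ := imageChartedSpace hρ.continuous hρρ h he
  have := isManifold_imageChartedSpace hρ hρρ h he
  have himm : Manifold.IsImmersionOfComplement B 𝓘(ℂ, A) 𝓘(ℂ, E) 1
      (Subtype.val : range ρ → X) := by
    intro q
    refine Manifold.IsImmersionAtOfComplement.mk_of_charts (L q) (chartAt A q) (e q) (he q) (he q)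
      (IsManifold.chart_mem_maximalAtlas q) (h q).mem_maximalAtlas subset_rfl fun u hu => ?_
    simp only [OpenPartialHomeomorph.extend, modelWithCornersSelf_partialEquiv,
      PartialEquiv.trans_refl] at hu ⊢
    exact (h q).map_imageChart_symm hρ.continuous hρρ hu
  exact ⟨himm.isImmersion, Topology.IsEmbedding.subtypeVal⟩

lemma mdifferentiable_rangeFactorization_imageChartedSpace [ProperSpace A]
    [IsManifold 𝓘(ℂ, E) 1 X] (hρ : MDifferentiable 𝓘(ℂ, E) 𝓘(ℂ, E) ρ)
    (hρρ : ∀ z, ρ (ρ z) = ρ z) (h : ∀ q, IsLinearizingChart ρ (firstProjection (L q)) (e q))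
    (he : ∀ q : range ρ, (q : X) ∈ (e q).source) :
    letI := imageChartedSpace hρ.continuous hρρ h he
    MDifferentiable 𝓘(ℂ, E) 𝓘(ℂ, A) (rangeFactorization ρ) := by
  let _ := imageChartedSpace hρ.continuous hρρ h he
  have := isManifold_imageChartedSpace hρ hρρ h he
  intro x
  set q := rangeFactorization ρ x with hq
  have hqs : ρ x ∈ (e q).source := he q
  have hd : MDifferentiableAt 𝓘(ℂ, E) 𝓘(ℂ, A) (fun z => ((L q).symm (e q (ρ z))).1) x := by
    refine MDifferentiableAt.comp (g := fun v => ((L q).symm v).1) (f := fun z => e q (ρ z)) x ?_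
      (MDifferentiableAt.comp (g := e q) (f := ρ) x
        ((contMDiffAt_of_mem_maximalAtlas (h q).mem_maximalAtlas hqs).mdifferentiableAt
          one_ne_zero) (hρ x))
    rw [mdifferentiableAt_iff_differentiableAt]
    fun_prop
  have hc : q ∈ (chartAt A q).source := mem_chart_source A q
  have h1 : MDifferentiableAt 𝓘(ℂ, E) 𝓘(ℂ, A)
      ((chartAt A q).symm ∘ fun z => ((L q).symm (e q (ρ z))).1) x :=
    MDifferentiableAt.comp x (mdifferentiableAt_atlas_symm (chart_mem_atlas A q)
      ((chartAt A q).map_source hc)) hd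
  refine h1.congr_of_eventuallyEq ?_
  filter_upwards [hρ.continuous.continuousAt.preimage_mem_nhds
    ((e q).open_source.mem_nhds hqs)] with z hz
  exact ((chartAt A q).left_inv (show rangeFactorization ρ z ∈ (chartAt A q).source from hz)).symm

end SubmanifoldStructure

/-- The image of a holomorphic retraction of a connected complex manifold is a closed complex
submanifold, onto which the retraction is holomorphic. -/
theorem exists_isClosedComplexSubmanifold_range {n : ℕ} {X : Type*} [TopologicalSpace X]
    [T2Space X] [ConnectedSpace X] [ChartedSpace (ComplexSpace n) X]
    [IsManifold 𝓘(ℂ, ComplexSpace n) 1 X] {ρ : X → X}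
    (hρ : MDifferentiable 𝓘(ℂ, ComplexSpace n) 𝓘(ℂ, ComplexSpace n) ρ)
    (hρρ : ∀ z, ρ (ρ z) = ρ z) :
    ∃ (d : ℕ) (_ : ChartedSpace (ComplexSpace d) (Set.range ρ)),
      IsClosedComplexSubmanifold n d (Set.range ρ) ∧
      MDifferentiable 𝓘(ℂ, ComplexSpace n) 𝓘(ℂ, ComplexSpace d) (Set.rangeFactorization ρ) := by
  have hfix : ∀ q : Set.range ρ, ρ q = q := by
    rintro ⟨_, z, rfl⟩
    exact hρρ z
  choose P e hP he hPe using fun q : Set.range ρ => exists_isLinearizingChart hρ hρρ (hfix q)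
  -- the rank of the linearization is locally constant on the connected image
  have hloc : IsLocallyConstant fun q =>
      Module.finrank ℂ (LinearMap.range (P q : ComplexSpace n →ₗ[ℂ] ComplexSpace n)) := by
    refine (IsLocallyConstant.iff_eventually_eq _).2 fun q => ?_
    filter_upwards [((e q).open_source.preimage continuous_subtype_val).mem_nhds (he q)] with q' hq'
    exact (hPe q').finrank_range_eq (hPe q) (hfix q') (he q') hq'
  have hconn : PreconnectedSpace (Set.range ρ) :=
    isPreconnected_iff_preconnectedSpace.1 (isPreconnected_range hρ.continuous)
  obtain ⟨x₀⟩ : Nonempty X := inferInstance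
  set q₀ := Set.rangeFactorization ρ x₀
  choose L hL using fun q => exists_eq_firstProjection (hP q)
    (hloc.apply_eq_of_preconnectedSpace q q₀) (finrank_euclideanSpace_fin (𝕜 := ℂ) (n := n))
  have h : ∀ q, IsLinearizingChart ρ (firstProjection (L q)) (e q) := fun q => hL q ▸ hPe q
  refine ⟨_, imageChartedSpace hρ.continuous hρρ h he, @IsClosedComplexSubmanifold.mk n _ X _ _ _
    (imageChartedSpace hρ.continuous hρρ h he) ?_ (isManifold_imageChartedSpace hρ hρρ h he)
    (isSmoothEmbedding_imageChartedSpace hρ hρρ h he),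
    mdifferentiable_rangeFactorization_imageChartedSpace hρ hρρ h he⟩
  have : Set.range ρ = {z | ρ z = z} :=
    Set.Subset.antisymm (by rintro _ ⟨z, rfl⟩; exact hρρ z) fun z hz => ⟨z, hz⟩
  rw [this]
  exact isClosed_eq hρ.continuous continuous_id

/-! ### Self-maps of a retract -/

section Retract

open Set

variable {X : Type*} [TopologicalSpace X]

/-- The self-map of `range ρ` obtained from a self-map `u` of `X` by restricting to `range ρ` and
applying `ρ`. -/
def retractMap (ρ u : C(X, X)) : C(range ρ, range ρ) :=
  (⟨rangeFactorization ρ, ρ.continuous.rangeFactorization⟩ : C(X, range ρ)).comp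
    (u.comp ⟨Subtype.val, continuous_subtype_val⟩)

/-- The self-map `γ ∘ ρ` of `X`, for a self-map `γ` of `range ρ`. -/
def extendMap (ρ : C(X, X)) (γ : C(range ρ, range ρ)) : C(X, X) :=
  (⟨Subtype.val, continuous_subtype_val⟩ : C(range ρ, X)).comp
    (γ.comp ⟨rangeFactorization ρ, ρ.continuous.rangeFactorization⟩)

lemma continuous_retractMap (ρ : C(X, X)) : Continuous (retractMap ρ) :=
  (ContinuousMap.continuous_postcomp _).comp (ContinuousMap.continuous_precomp _)

lemma continuous_extendMap (ρ : C(X, X)) : Continuous (extendMap ρ) :=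
  (ContinuousMap.continuous_postcomp _).comp (ContinuousMap.continuous_precomp _)

lemma coe_retractMap_apply {ρ u : C(X, X)} (h : ρ.comp u = u) (z : range ρ) :
    (retractMap ρ u z : X) = u z :=
  DFunLike.congr_fun h (z : X)

lemma apply_coe_range {ρ : C(X, X)} (hρ : ρ.comp ρ = ρ) (z : range ρ) : ρ z = z := by
  obtain ⟨_, w, rfl⟩ := z
  exact DFunLike.congr_fun hρ w

lemma rangeFactorization_coe {ρ : C(X, X)} (hρ : ρ.comp ρ = ρ) (z : range ρ) :
    rangeFactorization ρ z = z :=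
  Subtype.ext (apply_coe_range hρ z)

end Retract

section Automorphisms

open Set Filter

variable {E : Type*} [NormedAddCommGroup E] [NormedSpace ℂ E] {M : Type*} [TopologicalSpace M]
  [ChartedSpace E M]

/-- An automorphism as a continuous map. -/
def HolomorphicAut.toContinuousMap (γ : HolomorphicAut 𝓘(ℂ, E) M) : C(M, M) :=
  ⟨γ.1, γ.1.continuous⟩

lemma HolomorphicAut.isInducing_toContinuousMap :
    Topology.IsInducing (HolomorphicAut.toContinuousMap : HolomorphicAut 𝓘(ℂ, E) M → C(M, M)) :=
  ⟨rfl⟩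

lemma HolomorphicAut.ext_apply {γ γ' : HolomorphicAut 𝓘(ℂ, E) M} (h : ∀ z, γ.1 z = γ'.1 z) :
    γ = γ' :=
  Subtype.ext (Homeomorph.ext h)

lemma HolomorphicAut.mul_apply (γ γ' : HolomorphicAut 𝓘(ℂ, E) M) (z : M) :
    (γ * γ').1 z = γ.1 (γ'.1 z) := rfl

end Automorphisms

/-! ### Limit maps as automorphisms of the retract -/

/-- A limit map of `f` restricts to an automorphism of the retract `ρ(X)`, where `ρ` is the neutral
element of the group of limit maps: the inverse is the restriction of the inverse limit map. -/
lemma exists_holomorphicAut_of_mem_limitMaps {E A : Type*} [NormedAddCommGroup E] [NormedSpace ℂ E]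
    [ProperSpace E] [NormedAddCommGroup A] [NormedSpace ℂ A] {X : Type*} [TopologicalSpace X]
    [T2Space X] [LocallyCompactSpace X] [ChartedSpace E X] [IsManifold 𝓘(ℂ, E) 1 X] {f ρ : C(X, X)}
    (hf : MDifferentiable 𝓘(ℂ, E) 𝓘(ℂ, E) f) [ChartedSpace A (Set.range ρ)]
    (hρ : MDifferentiable 𝓘(ℂ, E) 𝓘(ℂ, A) (Set.rangeFactorization ρ))
    (hι : MDifferentiable 𝓘(ℂ, A) 𝓘(ℂ, E) (Subtype.val : Set.range ρ → X))
    (hρΓ : ρ ∈ limitMaps f) (hunit : ∀ h ∈ limitMaps f, ρ.comp h = h)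
    (hinv : ∀ h ∈ limitMaps f, ∃ h' ∈ limitMaps f, h'.comp h = ρ) {h : C(X, X)}
    (hh : h ∈ limitMaps f) :
    ∃ γ : HolomorphicAut 𝓘(ℂ, A) (Set.range ρ), ∀ z : Set.range ρ, (γ.1 z : X) = h z := by
  obtain ⟨h', hh', hh'h⟩ := hinv h hh
  have hhh' : h.comp h' = ρ := by rw [← hh'h, comp_comm_of_mem_limitMaps hh hh']
  have hleft : ∀ {u v : C(X, X)}, u ∈ limitMaps f → v ∈ limitMaps f → v.comp u = ρ →
      Function.LeftInverse (retractMap ρ v) (retractMap ρ u) := fun {u v} hu hv huv z => by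
    refine Subtype.ext ?_
    rw [coe_retractMap_apply (hunit v hv), coe_retractMap_apply (hunit u hu)]
    exact (DFunLike.congr_fun huv (z : X)).trans (apply_coe_range (hunit ρ hρΓ) z)
  have hhol : ∀ {u : C(X, X)}, u ∈ limitMaps f → MDifferentiable 𝓘(ℂ, A) 𝓘(ℂ, A)
      (retractMap ρ u) := fun hu =>
    hρ.comp ((mdifferentiable_of_mem_limitMaps hf hu).comp hι)
  exact ⟨⟨{ toFun := retractMap ρ h
            invFun := retractMap ρ h'
            left_inv := hleft hh hh' hh'h
            right_inv := hleft hh' hh hhh'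
            continuous_toFun := (retractMap ρ h).continuous
            continuous_invFun := (retractMap ρ h').continuous }, hhol hh, hhol hh'⟩,
    fun z => coe_retractMap_apply (hunit h hh) z⟩

theorem mainTheorem1 (n : ℕ) (X : Type*) [TopologicalSpace X] [T2Space X]
    [SecondCountableTopology X] [ConnectedSpace X] [ChartedSpace (ComplexSpace n) X]
    [IsManifold 𝓘(ℂ, ComplexSpace n) 1 X] (hX : IsTaut 𝓘(ℂ, ComplexSpace n) X)
    (f : C(X, X)) (hf : MDifferentiable 𝓘(ℂ, ComplexSpace n) 𝓘(ℂ, ComplexSpace n) f)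
    (hdiv : ¬ IsCompactlyDivergent (fun k => iterateMap f k)) :
    ∃ ρ : C(X, X),
      -- `ρ` is the unique holomorphic retraction among the limit maps
      (IsHolomorphicRetraction 𝓘(ℂ, ComplexSpace n) ρ ∧ ρ ∈ limitMaps f) ∧
      (∀ ρ' : C(X, X), IsHolomorphicRetraction 𝓘(ℂ, ComplexSpace n) ρ' → ρ' ∈ limitMaps f →
        ρ' = ρ) ∧
      -- its image is a closed submanifold
      ∃ (d : ℕ) (_ : ChartedSpace (ComplexSpace d) (Set.range ρ)),
        IsClosedComplexSubmanifold n d (Set.range ρ) ∧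
        -- every limit map is an automorphism of the image composed with `ρ`
        (∀ h ∈ limitMaps f, ∃ γ : HolomorphicAut 𝓘(ℂ, ComplexSpace d) (Set.range ρ),
          ∀ x, h x = γ.1 (Set.rangeFactorization ρ x)) ∧
        -- `f` restricts to an automorphism `φ` of the image
        ∃ φ : HolomorphicAut 𝓘(ℂ, ComplexSpace d) (Set.range ρ),
          (∀ z : Set.range ρ, (φ.1 z : X) = f z) ∧
          -- the closure of the powers of `φ` is a subgroup, isomorphic to the set of limit maps
          -- with composition, through `γ ∘ ρ ↦ γ`
          ∃ G : Subgroup (HolomorphicAut 𝓘(ℂ, ComplexSpace d) (Set.range ρ)),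
            (G : Set (HolomorphicAut 𝓘(ℂ, ComplexSpace d) (Set.range ρ))) =
              closure (Set.range fun k : ℕ => φ ^ k) ∧
            ∃ Φ : limitMaps f ≃ₜ G,
              (∀ (h : limitMaps f) (x : X), h.1 x = (Φ h).1.1 (Set.rangeFactorization ρ x)) ∧
              ∀ h₁ h₂ : limitMaps f, ∃ hm : h₁.1.comp h₂.1 ∈ limitMaps f,
                Φ ⟨h₁.1.comp h₂.1, hm⟩ = Φ h₁ * Φ h₂ := by
  have : LocallyCompactSpace X := ChartedSpace.locallyCompactSpace (ComplexSpace n) X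
  obtain ⟨ρ, hρΓ, hunit, hinv⟩ := hX.exists_unit_limitMaps hf hdiv
  have hρρ : ρ.comp ρ = ρ := hunit ρ hρΓ
  have hρhol := mdifferentiable_of_mem_limitMaps hf hρΓ
  refine ⟨ρ, ⟨⟨hρhol, hρρ⟩, hρΓ⟩, fun ρ' hρ' hρ'Γ => ?_, ?_⟩
  · -- an idempotent of a group is the neutral element
    obtain ⟨h, -, hh⟩ := hinv ρ' hρ'Γ
    rw [← hunit ρ' hρ'Γ, ← hh, ContinuousMap.comp_assoc, hρ'.2, hh]
  obtain ⟨d, _, hsub, hρM⟩ :=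
    exists_isClosedComplexSubmanifold_range hρhol (DFunLike.congr_fun hρρ)
  have hι : MDifferentiable 𝓘(ℂ, ComplexSpace d) 𝓘(ℂ, ComplexSpace n)
      (Subtype.val : Set.range ρ → X) := hsub.isEmbedding.contMDiff.mdifferentiable one_ne_zero
  choose Ψ hΨ using fun h : limitMaps f =>
    exists_holomorphicAut_of_mem_limitMaps hf hρM hι hρΓ hunit hinv h.2
  have hcomp : ∀ (h : limitMaps f) (x : X), h.1 x = (Ψ h).1 (Set.rangeFactorization ρ x) :=
    fun h x => by
      rw [hΨ]
      exact (DFunLike.congr_fun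
        ((comp_comm_of_mem_limitMaps h.2 hρΓ).trans (hunit _ h.2)) x).symm
  have hΨmul : ∀ h₁ h₂ : limitMaps f,
      Ψ ⟨h₁.1.comp h₂.1, comp_mem_limitMaps h₁.2 h₂.2⟩ = Ψ h₁ * Ψ h₂ := fun h₁ h₂ =>
    HolomorphicAut.ext_apply fun z => Subtype.ext <| by
      rw [HolomorphicAut.mul_apply, hΨ, hΨ, hΨ]
      rfl
  have hΨone : Ψ ⟨ρ, hρΓ⟩ = 1 := HolomorphicAut.ext_apply fun z => Subtype.ext <| by
    rw [hΨ]
    exact apply_coe_range hρρ z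
  set φ := Ψ ⟨f.comp ρ, comp_self_mem_limitMaps hρΓ⟩ with hφ
  have hφf : ∀ z : Set.range ρ, (φ.1 z : X) = f z := fun z => by
    rw [hφ, hΨ]
    exact congrArg f (apply_coe_range hρρ z)
  have hφk : ∀ (k : ℕ) (z : Set.range ρ), ((φ ^ k).1 z : X) = iterateMap f k z := fun k => by
    induction k with
    | zero => exact fun z => rfl
    | succ k ih =>
      intro z
      rw [pow_succ', HolomorphicAut.mul_apply, hφf, ih, iterateMap_succ]
      rfl
  -- the two directions of the correspondence between limit maps and automorphisms are continuous
  have hΨres : ∀ h : limitMaps f, (Ψ h).toContinuousMap = retractMap ρ h.1 := fun h =>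
    ContinuousMap.ext fun z => Subtype.ext <|
      (hΨ h z).trans (coe_retractMap_apply (hunit _ h.2) z).symm
  have hΨcont : Continuous Ψ := by
    rw [HolomorphicAut.isInducing_toContinuousMap.continuous_iff]
    have : HolomorphicAut.toContinuousMap ∘ Ψ = fun h : limitMaps f => retractMap ρ h.1 :=
      funext hΨres
    rw [this]
    exact (continuous_retractMap ρ).comp continuous_subtype_val
  set S : HolomorphicAut 𝓘(ℂ, ComplexSpace d) (Set.range ρ) → C(X, X) :=
    fun γ => extendMap ρ γ.toContinuousMap with hS
  have hScont : Continuous S :=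
    (continuous_extendMap ρ).comp HolomorphicAut.isInducing_toContinuousMap.continuous
  have hSΨ : ∀ h : limitMaps f, S (Ψ h) = h.1 := fun h =>
    ContinuousMap.ext fun x => (hcomp h x).symm
  have hΨS : ∀ (γ) (hγ : S γ ∈ limitMaps f), Ψ ⟨S γ, hγ⟩ = γ := fun γ hγ =>
    HolomorphicAut.ext_apply fun z => Subtype.ext <| by
      rw [hΨ]
      exact congrArg (fun w => (γ.1 w : X)) (rangeFactorization_coe hρρ z)
  have hrange : Set.range Ψ = closure (Set.range fun k : ℕ => φ ^ k) := by
    refine Set.Subset.antisymm ?_ fun γ hγ => ?_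
    · rintro _ ⟨h, rfl⟩
      obtain ⟨k, -, hk⟩ := h.2
      refine mem_closure_of_tendsto (f := fun ν => φ ^ k ν) (b := Filter.atTop) ?_
        (Filter.Eventually.of_forall fun ν => Set.mem_range_self (k ν))
      rw [HolomorphicAut.isInducing_toContinuousMap.tendsto_nhds_iff, hΨres]
      have hres : ∀ k, (φ ^ k).toContinuousMap = retractMap ρ (iterateMap f k) := fun k =>
        ContinuousMap.ext fun z => by
          rw [← rangeFactorization_coe hρρ ((φ ^ k).toContinuousMap z)]
          exact congrArg _ (hφk k z)
      simp only [Function.comp_def, hres]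
      exact ((continuous_retractMap ρ).tendsto _).comp hk
    · have hmem : ∀ k : ℕ, S (φ ^ k) ∈ limitMaps f := fun k => by
        have hSk : S (φ ^ k) = (iterateMap f k).comp ρ := ContinuousMap.ext fun x => hφk k _
        rw [hSk]
        clear hSk
        induction k with
        | zero => exact hρΓ
        | succ k ih =>
          rw [iterateMap_succ, ContinuousMap.comp_assoc]
          exact comp_self_mem_limitMaps ih
      have hSγ : S γ ∈ limitMaps f := (isClosed_limitMaps f).closure_subset
        (map_mem_closure hScont hγ (by rintro _ ⟨k, rfl⟩; exact hmem k))
      exact ⟨⟨S γ, hSγ⟩, hΨS γ hSγ⟩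
  let G : Subgroup (HolomorphicAut 𝓘(ℂ, ComplexSpace d) (Set.range ρ)) :=
    { carrier := Set.range Ψ
      mul_mem' := by
        rintro _ _ ⟨h₁, rfl⟩ ⟨h₂, rfl⟩
        exact ⟨_, hΨmul h₁ h₂⟩
      one_mem' := ⟨_, hΨone⟩
      inv_mem' := by
        rintro _ ⟨h, rfl⟩
        obtain ⟨h', hh', hh'h⟩ := hinv h.1 h.2
        refine ⟨⟨h', hh'⟩, eq_inv_of_mul_eq_one_left ?_⟩
        rw [← hΨmul, ← hΨone]
        exact congrArg Ψ (Subtype.ext hh'h) }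
  refine ⟨d, _, hsub, fun h hh => ⟨Ψ ⟨h, hh⟩, hcomp ⟨h, hh⟩⟩, φ, hφf, G, hrange, ?_⟩
  have hSG : ∀ γ : G, S γ.1 ∈ limitMaps f := by
    rintro ⟨_, h, rfl⟩
    rw [hSΨ]
    exact h.2
  exact ⟨{ toFun := fun h => ⟨Ψ h, h, rfl⟩
           invFun := fun γ => ⟨S γ.1, hSG γ⟩
           left_inv := fun h => Subtype.ext (hSΨ h)
           right_inv := fun γ => Subtype.ext (hΨS γ.1 (hSG γ))
           continuous_toFun := hΨcont.subtype_mk _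
           continuous_invFun := (hScont.comp continuous_subtype_val).subtype_mk _ },
    hcomp, fun h₁ h₂ => ⟨comp_mem_limitMaps h₁.2 h₂.2, Subtype.ext (hΨmul h₁ h₂)⟩⟩
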